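/- Let $\mathbf{k}$ be an algebraically closed field of characteristic zero, $N=\mathbb{Z}^n$ a lattice with dual lattice $N^\vee$ and pairing $\langle\cdot,\cdot\rangle$, and $\Delta_{\mathbb{Q}}\subset N_{\mathbb{Q}}$ a polyhedral cone containing no line. Put $\Delta^\vee=\{m\in N^\vee : \langle x,m\rangle\ge 0 \text{ for all } x\in\Delta_{\mathbb{Q}}\}$ and let $X=\operatorname{Spec}\bigoplus_{m\in\Delta^\vee}\mathbf{k}\chi^m$ be the corresponding normal affine toric variety. Assume that $X$ has no torus factor, that is, $X\not\cong Y\times(\mathbf{k}\setminus\{0\})$ for every variety $Y$. The ray generators of $\Delta_{\mathbb{Q}}$ are the primitive lattice vectors on its extremal rays. A Demazure root attached to a ray generator $\rho$ is a vector $e\in N^\vee$ with $\langle\rho,e\rangle=-1$ and $\langle\rho',e\rangle\ge 0$ for all ray generators $\rho'\ne\rho$. It defines the locally nilpotent derivation $\partial_{\rho,e}$ of $\mathcal{O}(X)$ given by $\partial_{\rho,e}(\chi^m)=\langle\rho,m\rangle\chi^{m+e}$, and the root subgroup $U_{\rho,e}=\{\exp(t\,\partial_{\rho,e}) : t\in\mathbf{k}\}$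 of $\operatorname{Aut}(X)$. Let $\rho_1\neq\rho_2$ be two different ray generators, let $e_1,e_2$ be Demazure roots attached to $\rho_1$ and $\rho_2$, respectively, and let $H=\langle U_1,U_2\rangle\subset\operatorname{Aut}(X)$ be the group generated by the root subgroups $U_i=U_{\rho_i,e_i}$, $i=1,2$. Put $c=\langle\rho_2,e_1\rangle$ and $d=\langle\rho_1,e_2\rangle$. Then exactly one of the following holds: (i) $H$ is a unipotent algebraic group, that is, there is a Zariski closed subgroup $G\subset \mathrm{GL}_r(\mathbf{k})$, for some $r$, consisting of unipotent matrices, and a regular action of $G$ on $X$ mapping $G$ isomorphically onto $H$; (ii) $H$ contains a free subgroup of rank two. Moreover, (i) holds if and only if $\min\{c,d\}=0$. -/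

import Mathlib

open scoped Matrix

universe u

noncomputable section

/-! ## Exponentials of locally nilpotent derivations -/

section LocallyNilpotent

variable {k A : Type*} [Field k] [CommRing A] [Algebra k A]

/-- A derivation `D` of a commutative `k`-algebra is locally nilpotent if every element is
annihilated by some power of `D`. -/
def IsLocallyNilpotent (D : Derivation k A A) : Prop :=
  ∀ f : A, ∃ N : ℕ, ((D : A →ₗ[k] A) ^ N) f = 0

/-- `exp (t D) f = ∑ₙ (tⁿ / n!) Dⁿ f`; the sum is finite if `D` is locally nilpotent. -/
def expSum (D : Derivation k A A) (t : k) (f : A) : A :=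
  ∑ᶠ n : ℕ, (t ^ n * (n.factorial : k)⁻¹) • ((D : A →ₗ[k] A) ^ n) f

lemma iterate_eq_zero_of_le {D : Derivation k A A} {f : A} {N n : ℕ}
    (h : ((D : A →ₗ[k] A) ^ N) f = 0) (hn : N ≤ n) : ((D : A →ₗ[k] A) ^ n) f = 0 := by
  obtain ⟨j, rfl⟩ := Nat.exists_eq_add_of_le' hn
  rw [pow_add, Module.End.mul_apply, h, map_zero]

lemma expSum_eq (D : Derivation k A A) (t : k) (f : A) (N : ℕ)
    (h : ((D : A →ₗ[k] A) ^ N) f = 0) :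
    expSum D t f =
      ∑ n ∈ Finset.range N, (t ^ n * (n.factorial : k)⁻¹) • ((D : A →ₗ[k] A) ^ n) f := by
  refine finsum_eq_sum_of_support_subset _ fun n hn => ?_
  by_contra hc
  simp only [Finset.coe_range, Set.mem_Iio, not_lt] at hc
  exact hn (by simp only [iterate_eq_zero_of_le h hc, smul_zero])

lemma sum_range_mul_range (N : ℕ) (F : ℕ → ℕ → A) (hF : ∀ i j, N ≤ i + j → F i j = 0) :
    ∑ i ∈ Finset.range N, ∑ j ∈ Finset.range N, F i j =
      ∑ n ∈ Finset.range N, ∑ p ∈ Finset.HasAntidiagonal.antidiagonal n, F p.1 p.2 := by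
  rw [← Finset.sum_product', Finset.sum_sigma']
  symm
  refine Finset.sum_of_injOn (fun x => x.2) ?_ ?_ ?_ ?_
  · rintro ⟨a, b⟩ ha ⟨c, d⟩ hc h
    simp only [Finset.coe_sigma, Set.mem_sigma_iff, Finset.mem_coe,
      Finset.HasAntidiagonal.mem_antidiagonal] at ha hc h
    subst h
    obtain rfl : a = c := by rw [← ha.2, ← hc.2]
    rfl
  · rintro ⟨a, b⟩ ha
    simp only [Finset.coe_sigma, Set.mem_sigma_iff, Finset.mem_coe, Finset.mem_range,
      Finset.HasAntidiagonal.mem_antidiagonal] at ha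
    simp only [Finset.coe_product, Set.mem_prod, Finset.mem_coe, Finset.mem_range]
    omega
  · rintro ⟨a, b⟩ _ hb
    refine hF a b ?_
    by_contra hc
    exact hb ⟨⟨a + b, (a, b)⟩, by simp; omega, rfl⟩
  · intros
    rfl

lemma iterate_mul (D : Derivation k A A) (n : ℕ) (f g : A) :
    ((D : A →ₗ[k] A) ^ n) (f * g) = ∑ p ∈ Finset.HasAntidiagonal.antidiagonal n,
      (n.choose p.1) • (((D : A →ₗ[k] A) ^ p.1) f * ((D : A →ₗ[k] A) ^ p.2) g) := by
  induction n with
  | zero => simp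
  | succ n ih =>
    rw [Finset.sum_antidiagonal_choose_succ_nsmul
      (fun i j => ((D : A →ₗ[k] A) ^ i) f * ((D : A →ₗ[k] A) ^ j) g)]
    rw [pow_succ', Module.End.mul_apply, ih, map_sum, ← Finset.sum_add_distrib]
    refine Finset.sum_congr rfl fun p hp => ?_
    rw [map_nsmul, pow_succ', pow_succ', Module.End.mul_apply, Module.End.mul_apply,
      Derivation.coeFn_coe, Derivation.leibniz, smul_eq_mul, smul_eq_mul, nsmul_add]
    have hc : n.choose p.2 = n.choose p.1 := by
      rw [← Finset.HasAntidiagonal.mem_antidiagonal.1 hp, Nat.choose_symm_add]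
    rw [hc, mul_comm (((D : A →ₗ[k] A) ^ p.2) g)]

lemma choose_mul_inv_factorial [CharZero k] (i j : ℕ) :
    ((i + j).factorial : k)⁻¹ * ((i + j).choose i : k) = (i.factorial : k)⁻¹ * (j.factorial : k)⁻¹ := by
  have h := Nat.choose_mul_factorial_mul_factorial (Nat.le_add_right i j)
  rw [Nat.add_sub_cancel_left] at h
  have h' : (((i + j).choose i : ℕ) : k) * i.factorial * j.factorial = (i + j).factorial := by
    exact_mod_cast h
  have h1 : (i.factorial : k) ≠ 0 := Nat.cast_ne_zero.2 (Nat.factorial_ne_zero i)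
  have h2 : (j.factorial : k) ≠ 0 := Nat.cast_ne_zero.2 (Nat.factorial_ne_zero j)
  have h3 : ((i + j).factorial : k) ≠ 0 := Nat.cast_ne_zero.2 (Nat.factorial_ne_zero _)
  field_simp
  rw [← h']

lemma expSum_mul [CharZero k] {D : Derivation k A A} (hD : IsLocallyNilpotent D) (t : k)
    (f g : A) : expSum D t (f * g) = expSum D t f * expSum D t g := by
  obtain ⟨N, hN⟩ := hD f
  obtain ⟨M, hM⟩ := hD g
  have hz : ∀ i j, N + M ≤ i + j →
      ((D : A →ₗ[k] A) ^ i) f * ((D : A →ₗ[k] A) ^ j) g = 0 := by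
    intro i j hij
    rcases le_or_gt N i with h | h
    · rw [iterate_eq_zero_of_le hN h, zero_mul]
    · rw [iterate_eq_zero_of_le hM (by omega), mul_zero]
  rw [expSum_eq D t f (N + M) (iterate_eq_zero_of_le hN (by omega)),
    expSum_eq D t g (N + M) (iterate_eq_zero_of_le hM (by omega)),
    expSum_eq D t (f * g) (N + M), Finset.sum_mul_sum, sum_range_mul_range]
  · refine Finset.sum_congr rfl fun n _ => ?_
    rw [iterate_mul, Finset.smul_sum]
    refine Finset.sum_congr rfl fun p hp => ?_
    obtain rfl := Finset.HasAntidiagonal.mem_antidiagonal.1 hp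
    rw [smul_mul_smul_comm, ← Nat.cast_smul_eq_nsmul k, smul_smul]
    congr 1
    rw [mul_assoc, choose_mul_inv_factorial, pow_add]
    ring
  · intro i j hij
    rw [smul_mul_smul_comm, hz i j hij, smul_zero]
  · rw [iterate_mul]
    refine Finset.sum_eq_zero fun p hp => ?_
    rw [hz _ _ (Finset.HasAntidiagonal.mem_antidiagonal.1 hp).ge, smul_zero]

lemma expSum_linear {D : Derivation k A A} (hD : IsLocallyNilpotent D) (t a : k)
    (f g : A) : expSum D t (a • f + g) = a • expSum D t f + expSum D t g := by
  obtain ⟨N, hN⟩ := hD f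
  obtain ⟨M, hM⟩ := hD g
  have h1 := iterate_eq_zero_of_le hN (Nat.le_add_right N M)
  have h2 := iterate_eq_zero_of_le hM (Nat.le_add_left M N)
  rw [expSum_eq D t f (N + M) h1, expSum_eq D t g (N + M) h2, expSum_eq D t _ (N + M)
    (by rw [map_add, map_smul, h1, h2, smul_zero, add_zero]), Finset.smul_sum,
    ← Finset.sum_add_distrib]
  refine Finset.sum_congr rfl fun n _ => ?_
  rw [map_add, map_smul, smul_add, smul_comm]

lemma expSum_one (D : Derivation k A A) (t : k) : expSum D t 1 = 1 := by
  rw [expSum_eq D t 1 1 (by simp)]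
  simp

lemma expSum_zero {D : Derivation k A A} (hD : IsLocallyNilpotent D) (f : A) :
    expSum D 0 f = f := by
  obtain ⟨N, hN⟩ := hD f
  rw [expSum_eq D 0 f (N + 1) (iterate_eq_zero_of_le hN (by omega)), Finset.sum_range_succ']
  simp

lemma expSum_add [CharZero k] {D : Derivation k A A} (hD : IsLocallyNilpotent D) (s t : k)
    (f : A) : expSum D (s + t) f = expSum D s (expSum D t f) := by
  obtain ⟨N, hN⟩ := hD f
  have hz : ∀ i j, N ≤ i + j → ((D : A →ₗ[k] A) ^ i) (((D : A →ₗ[k] A) ^ j) f) = 0 := by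
    intro i j hij
    rw [← Module.End.mul_apply, ← pow_add, iterate_eq_zero_of_le hN hij]
  rw [expSum_eq D t f N hN, expSum_eq D (s + t) f N hN, expSum_eq D s _ N]
  · simp only [map_sum, map_smul, Finset.smul_sum]
    rw [sum_range_mul_range N (fun i j => (s ^ i * (i.factorial : k)⁻¹) •
      (t ^ j * (j.factorial : k)⁻¹) • ((D : A →ₗ[k] A) ^ i) (((D : A →ₗ[k] A) ^ j) f))]
    · refine Finset.sum_congr rfl fun n _ => ?_
      rw [(Commute.all s t).add_pow', Finset.sum_mul, Finset.sum_smul]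
      refine Finset.sum_congr rfl fun p hp => ?_
      obtain rfl := Finset.HasAntidiagonal.mem_antidiagonal.1 hp
      rw [← Module.End.mul_apply, ← pow_add, smul_smul]
      congr 1
      rw [nsmul_eq_mul, mul_right_comm, mul_comm ((p.1 + p.2).choose p.1 : k),
        choose_mul_inv_factorial]
      ring
    · intro i j hij
      rw [hz i j hij, smul_zero, smul_zero]
  · rw [map_sum]
    refine Finset.sum_eq_zero fun j _ => ?_
    rw [map_smul, hz N j (by omega), smul_zero]

variable [CharZero k]

/-- `exp (t D)` as an endomorphism of the algebra `A`. -/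
def expHom (D : Derivation k A A) (hD : IsLocallyNilpotent D) (t : k) : A →ₐ[k] A :=
  AlgHom.ofLinearMap
    { toFun := expSum D t
      map_add' := fun f g => by simpa using expSum_linear hD t 1 f g
      map_smul' := fun a f => by
        have h0 : expSum D t 0 = 0 := by rw [expSum_eq D t 0 0 (map_zero _)]; simp
        simpa [h0] using expSum_linear hD t a f 0 }
    (expSum_one D t) (expSum_mul hD t)

/-- `exp (t D)` as an automorphism of the algebra `A`. -/
def expAut (D : Derivation k A A) (hD : IsLocallyNilpotent D) (t : k) : A ≃ₐ[k] A :=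
  AlgEquiv.ofAlgHom (expHom D hD t) (expHom D hD (-t))
    (AlgHom.ext fun f => by
      change expSum D t (expSum D (-t) f) = f
      rw [← expSum_add hD, add_neg_cancel, expSum_zero hD])
    (AlgHom.ext fun f => by
      change expSum D (-t) (expSum D t f) = f
      rw [← expSum_add hD, neg_add_cancel, expSum_zero hD])

lemma expAut_apply (D : Derivation k A A) (hD : IsLocallyNilpotent D) (t : k) (f : A) :
    expAut D hD t f = expSum D t f := rfl

/-- The one-parameter unipotent subgroup `{exp (t D) | t ∈ k}` of the automorphism group. -/
def expSubgroup (D : Derivation k A A) (hD : IsLocallyNilpotent D) : Subgroup (A ≃ₐ[k] A) where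
  carrier := {φ | ∃ t : k, φ = expAut D hD t}
  mul_mem' := by
    rintro _ _ ⟨s, rfl⟩ ⟨t, rfl⟩
    refine ⟨s + t, AlgEquiv.ext fun f => ?_⟩
    rw [AlgEquiv.mul_apply, expAut_apply, expAut_apply, expAut_apply, expSum_add hD]
  one_mem' := ⟨0, AlgEquiv.ext fun f => by
    rw [expAut_apply, expSum_zero hD, AlgEquiv.one_apply]⟩
  inv_mem' := by
    rintro _ ⟨t, rfl⟩
    refine ⟨-t, AlgEquiv.ext fun f => ?_⟩
    rfl

end LocallyNilpotent

/-! ## Normal affine toric varieties -/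

/-- The embedding of the lattice `N = ℤⁿ` into `N_ℚ = ℚⁿ`. -/
def latVec {n : ℕ} (v : Fin n → ℤ) : Fin n → ℚ := fun i => (v i : ℚ)

/-- A rational polyhedral cone `Δ_ℚ ⊆ N_ℚ = ℚⁿ`, `N = ℤⁿ`, containing no line. These cones
correspond to the normal affine toric varieties whose acting torus is `(𝔾ₘ)ⁿ`. -/
structure ToricCone (n : ℕ) where
  /-- the underlying cone -/
  cone : PointedCone ℚ (Fin n → ℚ)
  polyhedral : cone.FG
  salient : cone.toConvexCone.Salient

namespace ToricCone

variable {n : ℕ} (Δ : ToricCone n)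

/-- The dual lattice cone `Δ^∨ = {m ∈ N^∨ | ⟨x, m⟩ ≥ 0 for all x ∈ Δ_ℚ}`; the dual lattice
`N^∨` is `ℤⁿ` with the pairing `⟨ρ, m⟩ = ρ ⬝ᵥ m = ∑ i, ρ i * m i`. -/
def dualCone : AddSubmonoid (Fin n → ℤ) where
  carrier := {m | ∀ x ∈ Δ.cone, 0 ≤ x ⬝ᵥ latVec m}
  zero_mem' := by
    intro x _
    have h : latVec (0 : Fin n → ℤ) = 0 := by ext; simp [latVec]
    rw [h, dotProduct_zero]
  add_mem' := by
    intro a b ha hb x hx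
    have h : latVec (a + b) = latVec a + latVec b := by ext; simp [latVec]
    rw [h, dotProduct_add]
    exact add_nonneg (ha x hx) (hb x hx)

/-- The structure algebra `𝒪(X) = ⨁_{m ∈ Δ^∨} k χ^m` of the affine toric variety `X` of `Δ`. -/
abbrev CoordRing (k : Type u) [Field k] : Type u := AddMonoidAlgebra k Δ.dualCone

/-- The character `χ^m` as a regular function on `X`, for `m ∈ Δ^∨`. -/
abbrev chi (k : Type u) [Field k] (m : Δ.dualCone) : Δ.CoordRing k := AddMonoidAlgebra.single m 1

/-- `ρ ∈ N` is a ray generator of `Δ`: it is the primitive lattice vector on an extremal ray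
(one-dimensional face) `ℚ_{≥0} ρ` of `Δ_ℚ`. -/
structure IsRayGenerator (ρ : Fin n → ℤ) : Prop where
  ne_zero : ρ ≠ 0
  isFaceOf : (PointedCone.hull ℚ {latVec ρ}).IsFaceOf Δ.cone
  primitive : ∀ (c : ℕ) (v : Fin n → ℤ), ρ = c • v → c = 1

/-- `e` is a Demazure root of `Δ` lying on the Demazure facet of the ray generator `ρ`. -/
structure IsDemazureRoot (ρ e : Fin n → ℤ) : Prop where
  isRayGenerator : Δ.IsRayGenerator ρ
  pairing_self : ρ ⬝ᵥ e = -1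
  pairing_nonneg : ∀ ρ' : Fin n → ℤ, Δ.IsRayGenerator ρ' → ρ' ≠ ρ → 0 ≤ ρ' ⬝ᵥ e

lemma latVec_dotProduct (v m : Fin n → ℤ) : latVec v ⬝ᵥ latVec m = ((v ⬝ᵥ m : ℤ) : ℚ) := by
  simp [latVec, dotProduct]

/-- Every nonzero rational vector has a positive multiple that is a primitive lattice vector. -/
lemma exists_primitive (g : Fin n → ℚ) (hg : g ≠ 0) :
    ∃ (ρ : Fin n → ℤ) (c : ℚ), 0 < c ∧ latVec ρ = c • g ∧
      ∀ (c : ℕ) (v : Fin n → ℤ), ρ = c • v → c = 1 := by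
  obtain ⟨b, hb⟩ := IsLocalization.exist_integer_multiples_of_finite (nonZeroDivisors ℤ) g
  choose w hw using hb
  have hb0 : (b : ℤ) ≠ 0 := nonZeroDivisors.ne_zero b.2
  have hw' : ∀ i, ((w i : ℤ) : ℚ) = (b : ℤ) * g i := fun i => by
    have := hw i
    simpa using this
  set v : Fin n → ℤ := fun i => (b : ℤ).sign * w i with hv
  have hvg : ∀ i, (v i : ℚ) = ((|(b : ℤ)| : ℤ) : ℚ) * g i := fun i => by
    rw [hv]
    push_cast [hw' i]
    rw [← mul_assoc]
    congr 1
    have := Int.sign_mul_self_eq_abs (b : ℤ)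
    exact_mod_cast this
  obtain ⟨i₀, hi₀⟩ := Function.ne_iff.1 hg
  have hvi₀ : v i₀ ≠ 0 := by
    intro h
    have := hvg i₀
    rw [h, Int.cast_zero, eq_comm, mul_eq_zero] at this
    rcases this with h | h
    · exact hb0 (by simp at h)
    · exact hi₀ h
  obtain ⟨ρ, hρ, hρ1⟩ := Finset.extract_gcd v (s := Finset.univ) ⟨i₀, Finset.mem_univ _⟩
  set d := Finset.univ.gcd v with hd
  have hd0 : d ≠ 0 := fun h => hvi₀ (Finset.gcd_eq_zero_iff.1 h i₀ (Finset.mem_univ _))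
  have hdpos : 0 < d := lt_of_le_of_ne
    (Int.nonneg_of_normalize_eq_self (Finset.normalize_gcd)) hd0.symm
  have hdq : (0 : ℚ) < d := by exact_mod_cast hdpos
  refine ⟨ρ, (|(b : ℤ)| : ℤ) / d, ?_, ?_, ?_⟩
  · have : (0 : ℚ) < ((|(b : ℤ)| : ℤ) : ℚ) := by exact_mod_cast abs_pos.2 hb0
    positivity
  · ext i
    have h1 := hvg i
    rw [hρ i (Finset.mem_univ _)] at h1
    push_cast at h1
    simp only [latVec, Pi.smul_apply, smul_eq_mul]
    field_simp
    rw [mul_comm (ρ i : ℚ)]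
    push_cast
    linarith
  · intro c w hw
    have hdvd : (c : ℤ) ∣ Finset.univ.gcd ρ := Finset.dvd_gcd fun i _ => ⟨w i, by
      rw [hw]; simp⟩
    rw [hρ1] at hdvd
    exact_mod_cast Int.eq_one_of_dvd_one (by positivity) hdvd

/-- `Δ_ℚ` is generated by its ray generators; hence `Δ^∨` is cut out by them. -/
lemma mem_dualCone_iff (m : Fin n → ℤ) :
    m ∈ Δ.dualCone ↔ ∀ ρ : Fin n → ℤ, Δ.IsRayGenerator ρ → 0 ≤ ρ ⬝ᵥ m := by
  constructor
  · intro hm ρ hρ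
    have h := hm (latVec ρ) (hρ.isFaceOf.le (PointedCone.subset_hull rfl))
    rw [latVec_dotProduct] at h
    exact_mod_cast h
  intro hm
  obtain ⟨s, hs, hmin⟩ := (wellFounded_lt (α := Finset (Fin n → ℚ))).has_min
    {s | PointedCone.hull ℚ (s : Set (Fin n → ℚ)) = Δ.cone} Δ.polyhedral
  have key : ∀ g ∈ s, 0 ≤ g ⬝ᵥ latVec m := by
    intro g hg
    set t := s.erase g with ht
    have hst : (s : Set (Fin n → ℚ)) = insert g (t : Set (Fin n → ℚ)) := by
      rw [ht, ← Finset.coe_insert, Finset.insert_erase hg]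
    have hs' : PointedCone.hull ℚ (insert g (t : Set (Fin n → ℚ))) = Δ.cone := hst ▸ hs
    have htΔ : PointedCone.hull ℚ (t : Set (Fin n → ℚ)) ≤ Δ.cone := by
      rw [← hs']; exact Submodule.span_mono (Set.subset_insert _ _)
    have hgΔ : g ∈ Δ.cone := by
      rw [← hs']; exact Submodule.subset_span (Set.mem_insert _ _)
    have hgt : g ∉ PointedCone.hull ℚ (t : Set (Fin n → ℚ)) := by
      intro h
      refine hmin t ?_ (Finset.erase_ssubset hg)
      change PointedCone.hull ℚ (t : Set (Fin n → ℚ)) = Δ.cone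
      rw [← hs']
      exact (Submodule.span_insert_eq_span h).symm
    have hg0 : g ≠ 0 := fun h => hgt (h ▸ Submodule.zero_mem _)
    have hdec : ∀ x ∈ Δ.cone, ∃ α : ℚ, 0 ≤ α ∧
        ∃ x' ∈ PointedCone.hull ℚ (t : Set (Fin n → ℚ)), x = α • g + x' := by
      intro x hx
      rw [← hs'] at hx
      obtain ⟨α, x', hx', rfl⟩ := Submodule.mem_span_insert.1 hx
      exact ⟨α, α.2, x', hx', rfl⟩
    have hface : (PointedCone.hull ℚ {g}).IsFaceOf Δ.cone := by
      refine ⟨Submodule.span_le.2 (Set.singleton_subset_iff.2 hgΔ), ?_⟩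
      intro x y a hx hy ha hxy
      obtain ⟨b, hb⟩ := Submodule.mem_span_singleton.1 hxy
      obtain ⟨α, hα, x', hx', rfl⟩ := hdec x hx
      obtain ⟨β, hβ, y', hy', rfl⟩ := hdec y hy
      have hb' : (b : ℚ) • g = a • (α • g + x') + (β • g + y') := hb
      have hax : a • x' ∈ PointedCone.hull ℚ (t : Set (Fin n → ℚ)) :=
        PointedCone.smul_mem _ ha.le hx'
      have hsum : a • x' + y' = ((b : ℚ) - (a * α + β)) • g := by
        have h2 : a • x' + y' = (b : ℚ) • g - (a * α + β) • g := by
          rw [hb']; module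
        rw [h2]; module
      have hle : (b : ℚ) ≤ a * α + β := by
        by_contra hlt
        have hpos : 0 < (b : ℚ) - (a * α + β) := by linarith
        refine hgt ((PointedCone.smul_mem_iff _ hpos).1 ?_)
        rw [← hsum]
        exact Submodule.add_mem _ hax hy'
      have hzero : a • x' = 0 := by
        by_contra hne
        refine Δ.salient (a • x') (htΔ hax) hne ?_
        have h3 : -(a • x') = (a * α + β - b) • g + y' := by
          have : a • x' = ((b : ℚ) - (a * α + β)) • g - y' := by rw [← hsum]; module
          rw [this]; module
        rw [h3]
        exact Submodule.add_mem _ (PointedCone.smul_mem _ (by linarith) hgΔ) (htΔ hy')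
      have hx0 : x' = 0 := (smul_eq_zero.1 hzero).resolve_left ha.ne'
      rw [hx0, add_zero]
      exact PointedCone.smul_mem _ hα (PointedCone.subset_hull rfl)
    obtain ⟨ρ, c, hc, hρc, hprim⟩ := exists_primitive g hg0
    have hhull : PointedCone.hull ℚ {latVec ρ} = PointedCone.hull ℚ {g} := by
      apply le_antisymm
      · refine Submodule.span_le.2 (Set.singleton_subset_iff.2 ?_)
        rw [hρc]
        exact PointedCone.smul_mem _ hc.le (PointedCone.subset_hull rfl)
      · refine Submodule.span_le.2 (Set.singleton_subset_iff.2 ?_)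
        refine (PointedCone.smul_mem_iff _ hc).1 ?_
        rw [← hρc]
        exact PointedCone.subset_hull rfl
    have hray : Δ.IsRayGenerator ρ := by
      refine ⟨?_, hhull ▸ hface, hprim⟩
      rintro rfl
      have : latVec (0 : Fin n → ℤ) = 0 := by ext; simp [latVec]
      rw [this, eq_comm, smul_eq_zero] at hρc
      exact hρc.elim hc.ne' hg0
    have h4 : (0 : ℚ) ≤ latVec ρ ⬝ᵥ latVec m := by
      rw [latVec_dotProduct]; exact_mod_cast hm ρ hray
    rw [hρc, smul_dotProduct, smul_eq_mul] at h4
    exact nonneg_of_mul_nonneg_right h4 hc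
  intro x hx
  rw [← hs] at hx
  induction hx using Submodule.span_induction with
  | mem g hg => exact key g hg
  | zero => rw [zero_dotProduct]
  | add x y _ _ hx hy => rw [add_dotProduct]; exact add_nonneg hx hy
  | smul a x _ hx =>
    have : (a • x) ⬝ᵥ latVec m = (a : ℚ) * (x ⬝ᵥ latVec m) := smul_dotProduct (a : ℚ) x _
    rw [this]
    exact mul_nonneg a.2 hx

variable {Δ} {ρ e : Fin n → ℤ}

lemma pairing_nonneg (hρ : Δ.IsRayGenerator ρ) (m : Δ.dualCone) :
    0 ≤ ρ ⬝ᵥ (m : Fin n → ℤ) := (Δ.mem_dualCone_iff _).1 m.2 ρ hρ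

/-- If `m ∈ Δ^∨` and `⟨ρ, m⟩ ≠ 0`, then `m + e ∈ Δ^∨`. -/
lemma IsDemazureRoot.add_mem (h : Δ.IsDemazureRoot ρ e) (m : Δ.dualCone)
    (hm : ρ ⬝ᵥ (m : Fin n → ℤ) ≠ 0) : (m : Fin n → ℤ) + e ∈ Δ.dualCone := by
  rw [mem_dualCone_iff]
  intro ρ' hρ'
  rw [dotProduct_add]
  by_cases hc : ρ' = ρ
  · subst hc
    have := ToricCone.pairing_nonneg hρ' m
    rw [h.pairing_self]
    omega
  · exact add_nonneg (ToricCone.pairing_nonneg hρ' m) (h.pairing_nonneg ρ' hρ' hc)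

variable (k : Type u) [Field k]

open Classical in
/-- The value `⟨ρ, m⟩ χ^{m+e}` of the root derivation at `χ^m`; if `m + e ∉ Δ^∨`, then
`⟨ρ, m⟩ = 0` and the value is `0`. -/
def rootValue (Δ : ToricCone n) (ρ e : Fin n → ℤ) (m : Δ.dualCone) : Δ.CoordRing k :=
  if h : (m : Fin n → ℤ) + e ∈ Δ.dualCone then
    ((ρ ⬝ᵥ (m : Fin n → ℤ) : ℤ) : k) • Δ.chi k ⟨(m : Fin n → ℤ) + e, h⟩
  else 0

/-- The `k`-linear map `χ^m ↦ ⟨ρ, m⟩ χ^{m+e}`. -/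
def rootLinearMap (Δ : ToricCone n) (ρ e : Fin n → ℤ) : Δ.CoordRing k →ₗ[k] Δ.CoordRing k :=
  (Finsupp.lift (Δ.CoordRing k) k Δ.dualCone (rootValue k Δ ρ e)) ∘ₗ
    (AddMonoidAlgebra.coeffLinearEquiv k).toLinearMap

lemma rootLinearMap_chi (m : Δ.dualCone) :
    rootLinearMap k Δ ρ e (Δ.chi k m) = rootValue k Δ ρ e m := by
  simp [rootLinearMap, chi]

lemma chi_mul (m m' : Δ.dualCone) : Δ.chi k m * Δ.chi k m' = Δ.chi k (m + m') := by
  simp [chi, AddMonoidAlgebra.single_mul_single]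

lemma rootValue_of_pairing_eq_zero (m : Δ.dualCone) (hm : ρ ⬝ᵥ (m : Fin n → ℤ) = 0) :
    rootValue k Δ ρ e m = 0 := by
  unfold rootValue
  split_ifs
  · rw [hm, Int.cast_zero, zero_smul]
  · rfl

lemma rootValue_of_mem (m m' : Δ.dualCone) (hm : (m' : Fin n → ℤ) = (m : Fin n → ℤ) + e) :
    rootValue k Δ ρ e m = ((ρ ⬝ᵥ (m : Fin n → ℤ) : ℤ) : k) • Δ.chi k m' := by
  have h : (m : Fin n → ℤ) + e ∈ Δ.dualCone := hm ▸ m'.2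
  obtain rfl : m' = ⟨(m : Fin n → ℤ) + e, h⟩ := Subtype.ext hm
  rw [rootValue, dif_pos h]

lemma chi_mul_rootValue (h : Δ.IsDemazureRoot ρ e) (m m' m'' : Δ.dualCone)
    (hm : (m'' : Fin n → ℤ) = ((m + m' : Δ.dualCone) : Fin n → ℤ) + e) :
    Δ.chi k m * rootValue k Δ ρ e m' = ((ρ ⬝ᵥ (m' : Fin n → ℤ) : ℤ) : k) • Δ.chi k m'' := by
  by_cases h0 : ρ ⬝ᵥ (m' : Fin n → ℤ) = 0
  · rw [rootValue_of_pairing_eq_zero k m' h0, h0, mul_zero, Int.cast_zero, zero_smul]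
  · rw [rootValue_of_mem k m' ⟨_, h.add_mem m' h0⟩ rfl, mul_smul_comm, chi_mul]
    congr 2
    apply Subtype.ext
    rw [hm, AddSubmonoid.coe_add, AddSubmonoid.coe_add]
    exact (add_assoc _ _ _).symm

lemma rootValue_add (h : Δ.IsDemazureRoot ρ e) (m m' : Δ.dualCone) :
    rootValue k Δ ρ e (m + m') =
      Δ.chi k m * rootValue k Δ ρ e m' + Δ.chi k m' * rootValue k Δ ρ e m := by
  have hd : ρ ⬝ᵥ ((m + m' : Δ.dualCone) : Fin n → ℤ) =
      ρ ⬝ᵥ (m : Fin n → ℤ) + ρ ⬝ᵥ (m' : Fin n → ℤ) := dotProduct_add _ _ _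
  by_cases h0 : ρ ⬝ᵥ ((m + m' : Δ.dualCone) : Fin n → ℤ) = 0
  · have h1 := pairing_nonneg h.isRayGenerator m
    have h2 := pairing_nonneg h.isRayGenerator m'
    rw [rootValue_of_pairing_eq_zero k _ h0, rootValue_of_pairing_eq_zero k m (by omega),
      rootValue_of_pairing_eq_zero k m' (by omega), mul_zero, mul_zero, add_zero]
  · rw [chi_mul_rootValue k h m m' ⟨_, h.add_mem _ h0⟩ rfl,
      chi_mul_rootValue k h m' m ⟨_, h.add_mem _ h0⟩ (by
        simp only [AddSubmonoid.coe_add, add_comm (m : Fin n → ℤ)]),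
      rootValue_of_mem k (m + m') ⟨_, h.add_mem _ h0⟩ rfl, hd, ← add_smul]
    push_cast
    rw [add_comm]

lemma rootLinearMap_mul (h : Δ.IsDemazureRoot ρ e) (f g : Δ.CoordRing k) :
    rootLinearMap k Δ ρ e (f * g) =
      f • rootLinearMap k Δ ρ e g + g • rootLinearMap k Δ ρ e f := by
  have hs : ∀ (m : Δ.dualCone) (a : k),
      (AddMonoidAlgebra.single m a : Δ.CoordRing k) = a • Δ.chi k m := fun m a => by
    simp [chi]
  simp only [smul_eq_mul]
  induction f using AddMonoidAlgebra.induction_linear with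
  | zero => simp
  | add f₁ f₂ h₁ h₂ => rw [add_mul, map_add, h₁, h₂, map_add]; ring
  | single m a =>
    induction g using AddMonoidAlgebra.induction_linear with
    | zero => simp
    | add g₁ g₂ h₁ h₂ => rw [mul_add, map_add, h₁, h₂, map_add]; ring
    | single m' b =>
      rw [hs, hs, smul_mul_smul_comm, chi_mul, map_smul, map_smul, map_smul, rootLinearMap_chi,
        rootLinearMap_chi, rootLinearMap_chi, rootValue_add k h, smul_mul_smul_comm,
        smul_mul_smul_comm, smul_add, mul_comm b a]

/-- The root derivation `∂_{ρ,e}` of `𝒪(X)`, `∂_{ρ,e}(χ^m) = ⟨ρ, m⟩ χ^{m+e}`, of a Demazure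
root `e` on the Demazure facet of `ρ`. -/
def rootDerivation (h : Δ.IsDemazureRoot ρ e) :
    Derivation k (Δ.CoordRing k) (Δ.CoordRing k) :=
  Derivation.mk' (rootLinearMap k Δ ρ e) (rootLinearMap_mul k h)

lemma rootDerivation_chi (h : Δ.IsDemazureRoot ρ e) (m : Δ.dualCone) :
    rootDerivation k h (Δ.chi k m) = rootValue k Δ ρ e m := rootLinearMap_chi k m

lemma rootDerivation_chi_of_mem (h : Δ.IsDemazureRoot ρ e) (m m' : Δ.dualCone)
    (hm : (m' : Fin n → ℤ) = (m : Fin n → ℤ) + e) :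
    rootDerivation k h (Δ.chi k m) = ((ρ ⬝ᵥ (m : Fin n → ℤ) : ℤ) : k) • Δ.chi k m' := by
  rw [rootDerivation_chi, rootValue_of_mem k m m' hm]

lemma rootDerivation_pow_chi (h : Δ.IsDemazureRoot ρ e) (j : ℕ) : ∀ m : Δ.dualCone,
    ρ ⬝ᵥ (m : Fin n → ℤ) < j →
      ((rootDerivation k h : Δ.CoordRing k →ₗ[k] Δ.CoordRing k) ^ j) (Δ.chi k m) = 0 := by
  induction j with
  | zero =>
    intro m hm
    have := pairing_nonneg h.isRayGenerator m
    push_cast at hm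
    omega
  | succ j ih =>
    intro m hm
    rw [pow_succ, Module.End.mul_apply, Derivation.coeFn_coe, rootDerivation_chi]
    by_cases h0 : ρ ⬝ᵥ (m : Fin n → ℤ) = 0
    · rw [rootValue_of_pairing_eq_zero k m h0, map_zero]
    · rw [rootValue_of_mem k m ⟨_, h.add_mem m h0⟩ rfl, map_smul, ih, smul_zero]
      rw [dotProduct_add, h.pairing_self]
      push_cast at hm
      omega

lemma rootDerivation_isLocallyNilpotent (h : Δ.IsDemazureRoot ρ e) :
    IsLocallyNilpotent (rootDerivation k h) := by
  intro f
  induction f using AddMonoidAlgebra.induction_linear with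
  | zero => exact ⟨0, map_zero _⟩
  | add f g hf hg =>
    obtain ⟨N, hN⟩ := hf
    obtain ⟨M, hM⟩ := hg
    exact ⟨N + M, by rw [map_add, iterate_eq_zero_of_le hN (by omega),
      iterate_eq_zero_of_le hM (by omega), add_zero]⟩
  | single m a =>
    refine ⟨(ρ ⬝ᵥ (m : Fin n → ℤ)).toNat + 1, ?_⟩
    have hs : (AddMonoidAlgebra.single m a : Δ.CoordRing k) = a • Δ.chi k m := by simp [chi]
    rw [hs, map_smul, rootDerivation_pow_chi, smul_zero]
    have := Int.self_le_toNat (ρ ⬝ᵥ (m : Fin n → ℤ))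
    push_cast
    omega

/-- The root subgroup `U = {exp (t ∂_{ρ,e}) | t ∈ k}`, as a subgroup of the automorphism group
of the algebra `𝒪(X)` (which is anti-isomorphic, hence isomorphic, to `Aut X`). -/
def rootSubgroup [CharZero k] (h : Δ.IsDemazureRoot ρ e) :
    Subgroup (Δ.CoordRing k ≃ₐ[k] Δ.CoordRing k) :=
  expSubgroup (rootDerivation k h) (rootDerivation_isLocallyNilpotent k h)

end ToricCone

/-- The affine variety `X = Spec A` has a torus factor: `X ≅ Y × (k ∖ {0})`, that is,
`A ≅ B[t, t⁻¹]`. (Such a `B` is a quotient of `A`, so `Y = Spec B` is again an affine variety if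
`X` is one.) -/
def HasTorusFactor (k A : Type u) [Field k] [CommRing A] [Algebra k A] : Prop :=
  ∃ (B : Type u) (_ : CommRing B) (_ : Algebra k B), Nonempty (A ≃ₐ[k] LaurentPolynomial B)

/-! ## Unipotent algebraic groups of automorphisms and free subgroups -/

section Groups

variable {k : Type*} [Field k]

/-- The value of a polynomial in the `r²` matrix entries at an invertible matrix. -/
def evalEntries {r : ℕ} (P : MvPolynomial (Fin r × Fin r) k) (g : GL (Fin r) k) : k :=
  MvPolynomial.eval (fun ij => (g : Matrix (Fin r) (Fin r) k) ij.1 ij.2) P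

/-- A unipotent linear algebraic group: a Zariski closed subgroup of `GL_r(k)` consisting of
unipotent matrices. -/
structure IsUnipotentLinearAlgebraic {r : ℕ} (G : Subgroup (GL (Fin r) k)) : Prop where
  closed : ∃ I : Set (MvPolynomial (Fin r × Fin r) k),
    ∀ g : GL (Fin r) k, g ∈ G ↔ ∀ P ∈ I, evalEntries P g = 0
  unipotent : ∀ g ∈ G, IsNilpotent ((g : Matrix (Fin r) (Fin r) k) - 1)

/-- A group `H` of automorphisms of an affine variety `X = Spec A` is a unipotent algebraic group:
there are a unipotent linear algebraic group `G` and a regular action of `G` on `X` that maps `G`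
isomorphically onto `H`. Regularity means that every `f ∈ A` satisfies `g f = ∑ᵢ pᵢ(g) aᵢ` for
finitely many `aᵢ ∈ A` and regular functions `pᵢ` on `G`; since `det = 1` on a unipotent group,
the regular functions on `G` are the polynomials in the matrix entries. -/
def IsUnipotentAlgebraicGroup {A : Type*} [CommRing A] [Algebra k A]
    (H : Subgroup (A ≃ₐ[k] A)) : Prop :=
  ∃ (r : ℕ) (G : Subgroup (GL (Fin r) k)) (φ : G ≃* H), IsUnipotentLinearAlgebraic G ∧
    ∀ f : A, ∃ (d : ℕ) (a : Fin d → A) (p : Fin d → MvPolynomial (Fin r × Fin r) k),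
      ∀ g : G, (φ g : A ≃ₐ[k] A) f = ∑ i, evalEntries (p i) (g : GL (Fin r) k) • a i

/-- The group `H` contains a free subgroup of rank two. -/
def ContainsFreeGroupOfRankTwo (H : Type*) [Group H] : Prop :=
  ∃ f : FreeGroup (Fin 2) →* H, Function.Injective f

end Groups

end

/-! Everything is read off in two Cox coordinates `(f, g)`, on points `χ^m ↦ u(m) f^⟨ρ₁, m⟩ g^⟨ρ₂,
m⟩`. By the binomial theorem `exp (t ∂₁)` becomes `f ↦ f + t u(e₁) g^c` and `exp (t ∂₂)` becomes `g
↦ g + t u(e₂) f^d` (`coxPoint_comp_expAut`). The generic point `f = g = 1` over the Laurent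
polynomials has this form, so no information is lost.

If `d = 0`, the coordinates `x = f / (u(e₁) u(e₂)^c)` and `y = g / u(e₂)` turn `H` into the group of
all maps `(x, y) ↦ (x + Q(y), y + t)` with `deg Q ≤ c`: conjugating `x ↦ x + s y^c` by translations
gives `x ↦ x + s (y + t)^c`, and in characteristic zero the translates of `y^c` span
(`exists_shiftHom`). This group acts faithfully by unipotent matrices on the span of `1, y, …,
y^(c+1), x`, with closed image, and it is metabelian, hence without free subgroups of rank two. The
case `c = 0` is symmetric.

If `c, d > 0`, then `exp (2 ∂₁)` and `exp (2 ∂₂)` play ping-pong on the integral points with `|f| >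
|g| > 0` and `|g| > |f| > 0`. Unipotency is excluded by growth: in a unipotent algebraic group `h^j
F` is polynomial in `j`, of degree bounded independently of `h`, so one finite difference of order
`N` kills all these sequences (`IsUnipotentAlgebraicGroup.exists_sum_pow_eq_zero`). Along the powers
of `exp (s ∂₁) exp (s ∂₂)` the value of a suitable character at `(1, 1)` grows by a factor at least
`s` per step, which is impossible once `s > 2^N`. -/

/-! ## Farkas' lemma over an ordered field -/

/-- **Farkas' lemma**: a vector outside a finitely generated cone is separated from it by a linear
functional. -/
theorem exists_functional_of_not_mem_cone {K V ι : Type*} [Field K] [LinearOrder K]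
    [IsStrictOrderedRing K] [AddCommGroup V] [Module K V] [DecidableEq ι] (s : Finset ι) :
    ∀ (v : ι → V) (b : V), (∀ a : ι → K, (∀ i, 0 ≤ a i) → b ≠ ∑ i ∈ s, a i • v i) →
      ∃ l : V →ₗ[K] K, (∀ i ∈ s, 0 ≤ l (v i)) ∧ l b < 0 := by
  induction s using Finset.induction_on with
  | empty =>
    intro v b hb
    have hb0 : b ≠ 0 := by simpa using hb 0 (fun _ => le_rfl)
    obtain ⟨l, hl, -⟩ := Submodule.exists_le_ker_of_notMem (K := K) (p := (⊥ : Submodule K V))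
      (v := b) (by simpa using hb0)
    rcases lt_or_gt_of_ne hl with h | h
    · exact ⟨l, by simp, h⟩
    · exact ⟨-l, by simp, by simpa using h⟩
  | insert j s hj ih =>
    intro v b hb
    obtain ⟨l, hl, hlb⟩ := ih v b (by
      intro a ha h
      refine hb (fun i => if i = j then 0 else a i) ?_ ?_
      · intro i
        split_ifs
        exacts [le_rfl, ha i]
      · rw [h, Finset.sum_insert hj, if_pos rfl, zero_smul, zero_add]
        refine Finset.sum_congr rfl fun i hi => ?_
        rw [if_neg (ne_of_mem_of_not_mem hi hj)])
    by_cases hlj : 0 ≤ l (v j)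
    · exact ⟨l, by simpa [hlj] using hl, hlb⟩
    push Not at hlj
    -- `P` projects along `v j` onto the kernel of `l`; the new functional is found on the projected
    -- vectors and pulled back, so it vanishes at `v j`.
    let P : V →ₗ[K] V := LinearMap.id - (l.smulRight ((l (v j))⁻¹ • v j))
    have hP : ∀ x, P x = x - (l x * (l (v j))⁻¹) • v j := fun x => by
      simp [P, mul_smul]
    obtain ⟨l', hl', hlb'⟩ := ih (fun i => P (v i)) (P b) (by
      intro a ha h
      -- Undoing the projection forces this coefficient of `v j`. It is nonnegative because `l b <
      -- 0`, `l (v i) ≥ 0` and `l (v j) < 0`.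
      refine hb (fun i => if i = j then
        (l b - ∑ i ∈ s, a i * l (v i)) * (l (v j))⁻¹ else a i) ?_ ?_
      · intro i
        split_ifs
        · refine mul_nonneg_of_nonpos_of_nonpos ?_ (inv_nonpos.2 hlj.le)
          have := Finset.sum_nonneg fun i hi => mul_nonneg (ha i) (hl i hi)
          linarith
        · exact ha i
      · rw [Finset.sum_insert hj, if_pos rfl]
        have h1 : ∑ i ∈ s, (if i = j then (l b - ∑ i ∈ s, a i * l (v i)) * (l (v j))⁻¹ else a i) •
            v i = ∑ i ∈ s, a i • v i := Finset.sum_congr rfl fun i hi => by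
          rw [if_neg (ne_of_mem_of_not_mem hi hj)]
        rw [h1]
        simp only [hP, smul_sub, Finset.sum_sub_distrib, smul_smul, ← Finset.sum_smul] at h
        rw [sub_eq_iff_eq_add] at h
        simp only [sub_mul, Finset.sum_mul, sub_smul, mul_assoc]
        conv_lhs => rw [h]
        abel)
    have hPj : P (v j) = 0 := by
      rw [hP, mul_inv_cancel₀ hlj.ne, one_smul, sub_self]
    refine ⟨l' ∘ₗ P, ?_, hlb'⟩
    intro i hi
    rcases Finset.mem_insert.1 hi with rfl | hi
    · simp [hPj]
    · exact hl' i hi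

namespace ToricCone

variable {n : ℕ} {Δ : ToricCone n}

/-- The dual cone of a salient cone is not contained in the hyperplane orthogonal to a ray
generator. -/
theorem exists_pairing_pos {ρ : Fin n → ℤ} (hρ : Δ.IsRayGenerator ρ) :
    ∃ m : Δ.dualCone, 0 < ρ ⬝ᵥ (m : Fin n → ℤ) := by
  classical
  obtain ⟨s, hs⟩ := Δ.polyhedral
  have hρΔ : latVec ρ ∈ Δ.cone := hρ.isFaceOf.le (PointedCone.subset_hull rfl)
  have hρ0 : latVec ρ ≠ 0 := fun h => hρ.ne_zero <| funext fun i => by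
    have := congr_fun h i
    simpa [latVec] using this
  have hneg : -latVec ρ ∉ Δ.cone := Δ.salient _ hρΔ hρ0
  -- Separating `-ρ` from the cone gives a functional that is nonnegative on the cone and positive
  -- at `ρ`; clearing denominators makes it a lattice point.
  obtain ⟨l, hl, hlρ⟩ := exists_functional_of_not_mem_cone (K := ℚ) s id (-latVec ρ) (by
    intro a ha h
    refine hneg ?_
    rw [h, ← hs]
    exact Submodule.sum_mem _ fun i hi =>
      PointedCone.smul_mem _ (ha i) (Submodule.subset_span hi))
  set g : Fin n → ℚ := fun i => l (Pi.single i 1) with hg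
  have hlg : ∀ x, l x = x ⬝ᵥ g := fun x => by
    rw [LinearMap.pi_apply_eq_sum_univ l x]
    simp only [dotProduct, hg, smul_eq_mul]
    refine Finset.sum_congr rfl fun i _ => ?_
    congr 2
    ext j
    simp [Pi.single_apply, eq_comm]
  rw [map_neg, neg_lt_zero, hlg] at hlρ
  have hg0 : g ≠ 0 := by
    intro h
    rw [h, dotProduct_zero] at hlρ
    exact hlρ.false
  obtain ⟨m, c, hc, hm, -⟩ := exists_primitive g hg0
  refine ⟨⟨m, ?_⟩, ?_⟩
  · intro x hx
    rw [hm, dotProduct_smul]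
    refine mul_nonneg hc.le ?_
    rw [← hs] at hx
    induction hx using Submodule.span_induction with
    | mem y hy => rw [← hlg]; exact hl y hy
    | zero => rw [zero_dotProduct]
    | add x y _ _ hx hy => rw [add_dotProduct]; exact add_nonneg hx hy
    | smul a x _ hx =>
      have : (a • x) ⬝ᵥ g = (a : ℚ) * (x ⬝ᵥ g) := smul_dotProduct (a : ℚ) x _
      rw [this]
      exact mul_nonneg a.2 hx
  · have h : (0 : ℚ) < latVec ρ ⬝ᵥ latVec m := by
      rw [hm, dotProduct_smul]
      exact mul_pos hc hlρ
    rw [latVec_dotProduct] at h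
    exact_mod_cast h

/-! ## Points of a toric variety in Cox coordinates -/

variable {k : Type u} [Field k] {R : Type*} [CommRing R] [Algebra k R] {ρ₁ ρ₂ e₁ e₂ : Fin n → ℤ}

/-- The `R`-point `χ^m ↦ u(m) f^⟨ρ₁, m⟩ g^⟨ρ₂, m⟩` of `X`. -/
noncomputable def coxPoint (k : Type u) [Field k] [Algebra k R] (h₁ : Δ.IsRayGenerator ρ₁)
    (h₂ : Δ.IsRayGenerator ρ₂) (u : Multiplicative (Fin n → ℤ) →* R) (f g : R) :
    Δ.CoordRing k →ₐ[k] R :=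
  AddMonoidAlgebra.lift k R Δ.dualCone
    { toFun := fun m => u (.ofAdd (m.toAdd : Fin n → ℤ)) *
        (f ^ (ρ₁ ⬝ᵥ (m.toAdd : Fin n → ℤ)).toNat * g ^ (ρ₂ ⬝ᵥ (m.toAdd : Fin n → ℤ)).toNat)
      map_one' := by simp
      map_mul' := fun x y => by
        rw [toAdd_mul, AddSubmonoid.coe_add, dotProduct_add, dotProduct_add,
          Int.toNat_add (pairing_nonneg h₁ _) (pairing_nonneg h₁ _),
          Int.toNat_add (pairing_nonneg h₂ _) (pairing_nonneg h₂ _), ofAdd_add, map_mul,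
          pow_add, pow_add]
        ring }

theorem coxPoint_chi (h₁ : Δ.IsRayGenerator ρ₁) (h₂ : Δ.IsRayGenerator ρ₂)
    (u : Multiplicative (Fin n → ℤ) →* R) (f g : R) (m : Δ.dualCone) {a b : ℕ}
    (ha : ρ₁ ⬝ᵥ (m : Fin n → ℤ) = a) (hb : ρ₂ ⬝ᵥ (m : Fin n → ℤ) = b) :
    coxPoint k h₁ h₂ u f g (Δ.chi k m) = u (.ofAdd (m : Fin n → ℤ)) * (f ^ a * g ^ b) := by
  simp [coxPoint, AddMonoidAlgebra.lift_single, ha, hb]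

theorem exists_pairing_eq_nat {ρ : Fin n → ℤ} (hρ : Δ.IsRayGenerator ρ) (m : Δ.dualCone) :
    ∃ a : ℕ, ρ ⬝ᵥ (m : Fin n → ℤ) = a := Int.eq_ofNat_of_zero_le (pairing_nonneg hρ m)

theorem algHom_ext_chi {B : Type*} [Semiring B] [Algebra k B] {φ ψ : Δ.CoordRing k →ₐ[k] B}
    (h : ∀ m, φ (Δ.chi k m) = ψ (Δ.chi k m)) : φ = ψ :=
  AddMonoidAlgebra.algHom_ext h (Subsingleton.elim _ _)

/-- The symmetry through which results on the first coordinate apply to the second. -/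
theorem coxPoint_swap (h₁ : Δ.IsRayGenerator ρ₁) (h₂ : Δ.IsRayGenerator ρ₂)
    (u : Multiplicative (Fin n → ℤ) →* R) (f g : R) :
    coxPoint k h₁ h₂ u f g = coxPoint k h₂ h₁ u g f := by
  refine algHom_ext_chi fun m => ?_
  obtain ⟨a, ha⟩ := exists_pairing_eq_nat h₁ m
  obtain ⟨b, hb⟩ := exists_pairing_eq_nat h₂ m
  rw [coxPoint_chi h₁ h₂ u f g m ha hb, coxPoint_chi h₂ h₁ u g f m hb ha, mul_comm (f ^ a)]

/-- Each application of `∂` lowers the pairing with `ρ₁` by one, so the coefficients multiply to a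
falling factorial; as long as `j ≤ a` the exponent stays in the dual cone. -/
theorem exists_rootDerivation_pow_chi (h : Δ.IsDemazureRoot ρ₁ e₁) (j : ℕ) :
    ∀ (a : ℕ) (m : Δ.dualCone), ρ₁ ⬝ᵥ (m : Fin n → ℤ) = a → j ≤ a →
      ∃ m' : Δ.dualCone, (m' : Fin n → ℤ) = (m : Fin n → ℤ) + j • e₁ ∧
        ((rootDerivation k h : Δ.CoordRing k →ₗ[k] Δ.CoordRing k) ^ j) (Δ.chi k m) =
          (a.descFactorial j : k) • Δ.chi k m' := by
  induction j with
  | zero => intro a m _ _; exact ⟨m, by simp, by simp⟩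
  | succ j ih =>
    intro a m hm hj
    obtain ⟨a, rfl⟩ : ∃ a', a = a' + 1 := ⟨a - 1, by omega⟩
    have h0 : ρ₁ ⬝ᵥ (m : Fin n → ℤ) ≠ 0 := by rw [hm]; exact_mod_cast a.succ_ne_zero
    obtain ⟨m', hm', hD⟩ := ih a ⟨_, h.add_mem m h0⟩ (by
      change ρ₁ ⬝ᵥ ((m : Fin n → ℤ) + e₁) = a
      rw [dotProduct_add, hm, h.pairing_self]; push_cast; ring) (by omega)
    refine ⟨m', ?_, ?_⟩
    · rw [hm']
      change (m : Fin n → ℤ) + e₁ + j • e₁ = _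
      rw [succ_nsmul']; abel
    · rw [pow_succ, Module.End.mul_apply, Derivation.coeFn_coe,
        rootDerivation_chi_of_mem k h m ⟨_, h.add_mem m h0⟩ rfl, map_smul, hD, smul_smul, hm,
        Nat.succ_descFactorial_succ]
      push_cast
      rfl

/-- The action of a root subgroup on points in Cox coordinates. -/
theorem coxPoint_comp_expAut [CharZero k] (h : Δ.IsDemazureRoot ρ₁ e₁)
    (h₂ : Δ.IsRayGenerator ρ₂) {c : ℕ} (hc : ρ₂ ⬝ᵥ e₁ = c)
    (u : Multiplicative (Fin n → ℤ) →* R) (f g : R) (t : k) :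
    (coxPoint k h.isRayGenerator h₂ u f g).comp
        (expAut (rootDerivation k h) (rootDerivation_isLocallyNilpotent k h) t : _ →ₐ[k] _) =
      coxPoint k h.isRayGenerator h₂ u (f + t • (u (.ofAdd e₁) * g ^ c)) g := by
  refine algHom_ext_chi fun m => ?_
  obtain ⟨a, ha⟩ := exists_pairing_eq_nat h.isRayGenerator m
  obtain ⟨b, hb⟩ := exists_pairing_eq_nat h₂ m
  rw [coxPoint_chi _ h₂ u _ g m ha hb, AlgHom.comp_apply]
  change coxPoint k h.isRayGenerator h₂ u f g (expAut _ _ t (Δ.chi k m)) = _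
  rw [expAut_apply, expSum_eq _ _ _ (a + 1) (rootDerivation_pow_chi k h _ m (by rw [ha]; simp)),
    map_sum, add_comm f, add_pow, Finset.sum_mul, Finset.mul_sum]
  -- The exponential series and the binomial expansion of the new `f ^ a` agree term by term: `1 /
  -- j!` times the falling factorial is `a.choose j`.
  refine Finset.sum_congr rfl fun j hj => ?_
  have hja : j ≤ a := Nat.lt_succ_iff.1 (Finset.mem_range.1 hj)
  obtain ⟨m', hm', hD⟩ := exists_rootDerivation_pow_chi (k := k) h j a m ha hja
  rw [hD, smul_smul, map_smul, coxPoint_chi (a := a - j) (b := b + j * c) _ h₂ u f g m' (by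
      rw [hm', dotProduct_add, dotProduct_smul, h.pairing_self, ha]; push_cast [hja]; simp; ring)
    (by rw [hm', dotProduct_add, dotProduct_smul, hb, hc]; simp)]
  have hu : u (.ofAdd (m' : Fin n → ℤ)) = u (.ofAdd (m : Fin n → ℤ)) * u (.ofAdd e₁) ^ j := by
    rw [hm', ofAdd_add, map_mul, ofAdd_nsmul, map_pow]
  have hk : t ^ j * (j.factorial : k)⁻¹ * (a.descFactorial j : k) = t ^ j * (a.choose j : k) := by
    have : (j.factorial : k) ≠ 0 := Nat.cast_ne_zero.2 (Nat.factorial_ne_zero j)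
    rw [Nat.descFactorial_eq_factorial_mul_choose]
    push_cast
    field_simp
  rw [hu, hk, smul_pow, mul_smul, smul_mul_assoc, smul_mul_assoc, smul_mul_assoc, mul_smul_comm,
    Algebra.smul_def (a.choose j : k), map_natCast]
  congr 1
  ring

theorem coxPoint_expAut_apply [CharZero k] (h : Δ.IsDemazureRoot ρ₁ e₁)
    (h₂ : Δ.IsRayGenerator ρ₂) {c : ℕ} (hc : ρ₂ ⬝ᵥ e₁ = c)
    (u : Multiplicative (Fin n → ℤ) →* R) (f g : R) (t : k) (x : Δ.CoordRing k) :
    coxPoint k h.isRayGenerator h₂ u f g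
        (expAut (rootDerivation k h) (rootDerivation_isLocallyNilpotent k h) t x) =
      coxPoint k h.isRayGenerator h₂ u (f + t • (u (.ofAdd e₁) * g ^ c)) g x :=
  AlgHom.congr_fun (coxPoint_comp_expAut h h₂ hc u f g t) x

end ToricCone

/-! ## One-parameter unipotent groups -/

section OneParameter

variable {k A : Type*} [Field k] [CommRing A] [Algebra k A] [CharZero k]

/-- The homomorphism `t ↦ exp (t D)`. -/
noncomputable def expParam (D : Derivation k A A) (hD : IsLocallyNilpotent D) :
    Multiplicative k →* (A ≃ₐ[k] A) where
  toFun t := expAut D hD t.toAdd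
  map_one' := AlgEquiv.ext fun f => expSum_zero hD f
  map_mul' s t := AlgEquiv.ext fun f => expSum_add hD s.toAdd t.toAdd f

theorem expAut_zpow (D : Derivation k A A) (hD : IsLocallyNilpotent D) (t : k) (n : ℤ) :
    expAut D hD t ^ n = expAut D hD (n * t) := by
  have h := map_zpow (expParam D hD) (.ofAdd t) n
  rw [← ofAdd_zsmul, zsmul_eq_mul] at h
  exact h.symm

theorem expAut_mem_expSubgroup (D : Derivation k A A) (hD : IsLocallyNilpotent D) (t : k) :
    expAut D hD t ∈ expSubgroup D hD := ⟨t, rfl⟩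

end OneParameter

/-! ## A ping-pong criterion for automorphism groups of algebras -/

theorem FreeGroup.exists_eq_of_unit_zpow (x : FreeGroup Unit) : ∃ n : ℤ, x = FreeGroup.of () ^ n :=
  ⟨FreeGroup.freeGroupUnitEquivInt x, (FreeGroup.freeGroupUnitEquivInt.symm_apply_apply x).symm⟩

instance : Infinite (FreeGroup Unit) :=
  Infinite.of_injective _ FreeGroup.freeGroupUnitEquivInt.symm.injective

/-- Table-tennis lemma for two elements of infinite order. -/
theorem containsFreeGroupOfRankTwo_of_ping_pong {G α : Type*} [Group G] [MulAction G α]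
    (g : Fin 2 → G) (X : Fin 2 → Set α) (hne : ∀ i, (X i).Nonempty)
    (hdisj : Disjoint (X 0) (X 1))
    (hpp : ∀ i j, i ≠ j → ∀ n : ℤ, n ≠ 0 → ∀ x ∈ X j, g i ^ n • x ∈ X i) :
    ContainsFreeGroupOfRankTwo G := by
  let f : Fin 2 → FreeGroup Unit →* G := fun i => FreeGroup.lift fun _ => g i
  -- With only two factors, ping-pong requires a factor with at least three elements; here it is
  -- infinite cyclic.
  have hinj := Monoid.CoprodI.lift_injective_of_ping_pong f
    (Or.inr ⟨0, le_trans (by exact_mod_cast (Cardinal.natCast_lt_aleph0 (n := 3)).le)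
      (Cardinal.aleph0_le_mk _)⟩) X hne ?_ ?_
  · exact ⟨(Monoid.CoprodI.lift f).comp (freeGroupEquivCoprodI (ι := Fin 2)).toMonoidHom,
      hinj.comp (freeGroupEquivCoprodI (ι := Fin 2)).injective⟩
  · intro i j hij
    fin_cases i <;> fin_cases j
    · exact absurd rfl hij
    · exact hdisj
    · exact hdisj.symm
    · exact absurd rfl hij
  · intro i j hij h hh
    obtain ⟨n, rfl⟩ := FreeGroup.exists_eq_of_unit_zpow h
    have hn : n ≠ 0 := by
      rintro rfl
      exact hh (zpow_zero _)
    rintro _ ⟨x, hx, rfl⟩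
    have : f i (FreeGroup.of () ^ n) = g i ^ n := by simp [f]
    change f i (FreeGroup.of () ^ n) • x ∈ X i
    rw [this]
    exact hpp i j hij n hn x hx

/-- Automorphisms act on points by precomposition with the inverse. -/
@[reducible]
def AlgEquiv.pointAction (k A B : Type*) [CommSemiring k] [Semiring A] [Semiring B] [Algebra k A]
    [Algebra k B] : MulAction (A ≃ₐ[k] A) (A →ₐ[k] B) where
  smul h p := p.comp (h⁻¹ : A ≃ₐ[k] A)
  one_smul p := AlgHom.ext fun x => by
    change p ((1 : A ≃ₐ[k] A)⁻¹ x) = p x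
    rw [inv_one, AlgEquiv.one_apply]
  mul_smul g h p := AlgHom.ext fun x => by
    change p ((g * h)⁻¹ x) = p (h⁻¹ (g⁻¹ x))
    rw [mul_inv_rev, AlgEquiv.mul_apply]

/-! ## Unipotent algebraic groups act by polynomial iterates -/

section Unipotent

variable {k : Type*} [Field k]

/-- Cayley–Hamilton: the characteristic polynomial of a nilpotent matrix is a power of `X`. -/
theorem Matrix.pow_card_eq_zero_of_isNilpotent {ι : Type*} [Fintype ι] [DecidableEq ι]
    {M : Matrix ι ι k} (hM : IsNilpotent M) : M ^ Fintype.card ι = 0 := by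
  have h := (Matrix.isNilpotent_charpoly_sub_pow_of_isNilpotent hM).eq_zero
  rw [sub_eq_zero] at h
  have h1 := M.aeval_self_charpoly
  rwa [h, map_pow, Polynomial.aeval_X] at h1

open Polynomial in
-- Expand `M ^ n = (1 + (M - 1)) ^ n`. Only the terms with `l < r` survive, and `n.choose l` is a
-- polynomial in `n` of degree `l`.
theorem Matrix.exists_polynomial_pow_apply [CharZero k] {r : ℕ} {M : Matrix (Fin r) (Fin r) k}
    (hM : IsNilpotent (M - 1)) :
    ∃ P : Fin r × Fin r → k[X], (∀ ij, (P ij).natDegree ≤ r) ∧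
      ∀ (n : ℕ) (ij : Fin r × Fin r), (M ^ n) ij.1 ij.2 = (P ij).eval (n : k) := by
  refine ⟨fun ij => ∑ l ∈ Finset.range r,
    C ((l.factorial : k)⁻¹ * ((M - 1) ^ l) ij.1 ij.2) * descPochhammer k l, ?_, ?_⟩
  · intro ij
    refine natDegree_sum_le_of_forall_le _ _ fun l hl => (natDegree_C_mul_le _ _).trans ?_
    rw [descPochhammer_natDegree]
    exact (Finset.mem_range.1 hl).le
  · intro n ij
    have hz : ∀ l, r ≤ l → (M - 1) ^ l = 0 := fun l hl =>
      pow_eq_zero_of_le (by simpa using hl) (Matrix.pow_card_eq_zero_of_isNilpotent hM)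
    have h1 : M ^ n = ∑ l ∈ Finset.range r, (n.choose l) • (M - 1) ^ l := by
      conv_lhs => rw [← sub_add_cancel M 1, (Commute.one_right (M - 1)).add_pow]
      have e1 : ∑ l ∈ Finset.range (n + 1), (M - 1) ^ l * 1 ^ (n - l) * (n.choose l : Matrix _ _ k) =
          ∑ l ∈ Finset.range (n + 1 + r), (n.choose l) • (M - 1) ^ l := by
        rw [← Finset.sum_subset (Finset.range_mono (Nat.le_add_right (n + 1) r))]
        · refine Finset.sum_congr rfl fun l _ => ?_
          rw [one_pow, mul_one, nsmul_eq_mul, Nat.cast_comm]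
        · intro l _ hl
          rw [Nat.choose_eq_zero_of_lt (by simpa using hl), zero_smul]
      rw [e1]
      refine (Finset.sum_subset (Finset.range_mono (Nat.le_add_left r (n + 1))) ?_).symm
      intro l _ hl
      rw [hz l (by simpa using hl), smul_zero]
    rw [h1, Matrix.sum_apply, eval_finsetSum]
    refine Finset.sum_congr rfl fun l _ => ?_
    have hl : (l.factorial : k) ≠ 0 := Nat.cast_ne_zero.2 (Nat.factorial_ne_zero l)
    rw [Matrix.smul_apply, eval_mul, eval_C, descPochhammer_eval_eq_descFactorial,
      Nat.descFactorial_eq_factorial_mul_choose, nsmul_eq_mul]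
    push_cast
    field_simp

open Polynomial in
/-- In a unipotent algebraic group of automorphisms, the iterates of every element are polynomial,
with degrees bounded uniformly in the element. -/
theorem IsUnipotentAlgebraicGroup.exists_sum_pow_eq_zero [CharZero k] {A : Type*} [CommRing A]
    [Algebra k A] {H : Subgroup (A ≃ₐ[k] A)} (hH : IsUnipotentAlgebraicGroup H) (f : A) :
    ∃ N : ℕ, ∀ h ∈ H,
      ∑ j ∈ Finset.range (N + 1), ((-1) ^ (N - j) * (N.choose j : ℤ)) • (h ^ j) f = 0 := by
  obtain ⟨r, G, φ, hG, hφ⟩ := hH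
  obtain ⟨d, a, p, hp⟩ := hφ f
  -- Entries of `g ^ j` have degree at most `r` in `j`, so each `p i` has degree at most `B * r`
  -- along the powers of `g`. The bound depends on `f` alone.
  let B := ∑ i, (p i).totalDegree
  refine ⟨B * r + 1, fun h hh => ?_⟩
  obtain ⟨g, hg⟩ := φ.surjective ⟨h, hh⟩
  obtain ⟨P, hPdeg, hP⟩ := Matrix.exists_polynomial_pow_apply (hG.unipotent g g.2)
  have key : ∀ j : ℕ, (h ^ j) f = ∑ i, ((MvPolynomial.aeval P (p i)).eval (j : k)) • a i := by
    intro j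
    have h1 : ((φ (g ^ j) : H) : A ≃ₐ[k] A) = h ^ j := by rw [map_pow, hg]; rfl
    rw [← h1, hp]
    refine Finset.sum_congr rfl fun i _ => ?_
    congr 1
    rw [evalEntries, ← coe_evalRingHom, MvPolynomial.aeval_def, MvPolynomial.hom_eval₂,
      MvPolynomial.eval, MvPolynomial.coe_eval₂Hom]
    congr 1
    · ext x; simp
    · ext ij
      simpa using hP j ij
  have hdeg : ∀ i, (MvPolynomial.aeval P (p i)).natDegree < B * r + 1 := fun i =>
    Nat.lt_succ_of_le (MvPolynomial.aeval_natDegree_le (p i)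
      (Finset.single_le_sum (f := fun i => (p i).totalDegree) (fun _ _ => Nat.zero_le _)
        (Finset.mem_univ i)) P hPdeg)
  simp_rw [key, Finset.smul_sum]
  rw [Finset.sum_comm]
  refine Finset.sum_eq_zero fun i _ => ?_
  -- The alternating sum is an iterated forward difference at `0`, of order larger than the degree.
  have h2 := congr_fun (Polynomial.fwdDiff_iter_eq_zero_of_degree_lt (hdeg i)) 0
  rw [fwdDiff_iter_eq_sum_shift] at h2
  simp only [zero_add, nsmul_eq_mul, mul_one, Pi.zero_apply] at h2
  simp_rw [← smul_assoc]
  rw [← Finset.sum_smul, h2, zero_smul]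

end Unipotent

namespace ToricCone

variable {n : ℕ} {Δ : ToricCone n} {k : Type u} [Field k] [CharZero k] {ρ₁ ρ₂ e₁ e₂ : Fin n → ℤ}

/-! ## Two root subgroups in ping-pong position -/

/-- Points with nonzero integral Cox coordinates `(f, g)`, `|g| < |f|`. -/
def pingSet (k : Type u) [Field k] (h₁ : Δ.IsRayGenerator ρ₁) (h₂ : Δ.IsRayGenerator ρ₂) :
    Set (Δ.CoordRing k →ₐ[k] k) :=
  {p | ∃ f g : ℤ, g ≠ 0 ∧ |g| < |f| ∧ p = coxPoint k h₁ h₂ 1 (f : k) (g : k)}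

/-- Since `c ≥ 1` and `g` is a nonzero integer, `|2n g^c| ≥ 2|g|`; hence `|f + 2n g^c| ≥ 2|g| - |f|
> |g|`. The parameter `2` is what makes this work. -/
theorem comp_expAut_mem_pingSet (h₁ : Δ.IsDemazureRoot ρ₁ e₁) (h₂ : Δ.IsRayGenerator ρ₂) {c : ℕ}
    (hc : ρ₂ ⬝ᵥ e₁ = c) (hc0 : c ≠ 0) {n : ℤ} (hn : n ≠ 0) {p : Δ.CoordRing k →ₐ[k] k}
    (hp : p ∈ pingSet k h₂ h₁.isRayGenerator) :
    p.comp (expAut (rootDerivation k h₁) (rootDerivation_isLocallyNilpotent k h₁) (n * 2) :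
      _ →ₐ[k] _) ∈ pingSet k h₁.isRayGenerator h₂ := by
  obtain ⟨g, f, hf, hfg, rfl⟩ := hp
  have hg : g ≠ 0 := by
    rintro rfl
    rw [abs_zero] at hfg
    exact absurd hfg (abs_nonneg f).not_gt
  refine ⟨f + n * 2 * g ^ c, g, hg, ?_, ?_⟩
  · have h1 : 1 ≤ |n| := Int.one_le_abs hn
    have h2 : |g| ≤ |g| ^ c := le_self_pow₀ (Int.one_le_abs hg) hc0
    have h3 : |n * 2 * g ^ c| = |n| * 2 * |g| ^ c := by rw [abs_mul, abs_mul, abs_pow]; rfl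
    have h4 : |n * 2 * g ^ c| ≤ |f + n * 2 * g ^ c| + |f| := by
      have := abs_sub (f + n * 2 * g ^ c) f
      rwa [add_sub_cancel_left] at this
    have h5 : 1 * 2 * |g| ^ c ≤ |n| * 2 * |g| ^ c := by gcongr
    linarith
  · rw [coxPoint_swap, coxPoint_comp_expAut h₁ h₂ hc]
    congr 1
    push_cast
    simp

/-- The dual cone contains characters with independent pairings with `ρ₁` and `ρ₂`. -/
theorem exists_pairing_step (h₁ : Δ.IsDemazureRoot ρ₁ e₁) (h₂ : Δ.IsRayGenerator ρ₂) {c : ℕ}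
    (hc : ρ₂ ⬝ᵥ e₁ = c) : ∃ (a b : ℕ) (m m' : Δ.dualCone),
      ρ₁ ⬝ᵥ (m : Fin n → ℤ) = (a + 1 : ℕ) ∧ ρ₂ ⬝ᵥ (m : Fin n → ℤ) = b ∧
      ρ₁ ⬝ᵥ (m' : Fin n → ℤ) = a ∧ ρ₂ ⬝ᵥ (m' : Fin n → ℤ) = (b + c : ℕ) := by
  obtain ⟨m, hm⟩ := exists_pairing_pos h₁.isRayGenerator
  obtain ⟨a, ha⟩ : ∃ a : ℕ, ρ₁ ⬝ᵥ (m : Fin n → ℤ) = (a + 1 : ℕ) :=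
    ⟨(ρ₁ ⬝ᵥ (m : Fin n → ℤ)).toNat - 1, by omega⟩
  obtain ⟨b, hb⟩ := exists_pairing_eq_nat h₂ m
  refine ⟨a, b, m, ⟨_, h₁.add_mem m hm.ne'⟩, ha, hb, ?_, ?_⟩
  · change ρ₁ ⬝ᵥ ((m : Fin n → ℤ) + e₁) = a
    rw [dotProduct_add, ha, h₁.pairing_self]; push_cast; ring
  · change ρ₂ ⬝ᵥ ((m : Fin n → ℤ) + e₁) = _
    rw [dotProduct_add, hb, hc]; push_cast; ring

/-- A point need not determine its Cox coordinates, but two characters with independent exponents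
`(a + 1, b)` and `(a, b + c)` determine their absolute values. -/
theorem disjoint_pingSet (h₁ : Δ.IsDemazureRoot ρ₁ e₁) (h₂ : Δ.IsRayGenerator ρ₂) {c : ℕ}
    (hc : ρ₂ ⬝ᵥ e₁ = c) (hc0 : c ≠ 0) :
    Disjoint (pingSet k h₁.isRayGenerator h₂) (pingSet k h₂ h₁.isRayGenerator) := by
  rw [Set.disjoint_left]
  rintro p ⟨f, g, hg, hfg, rfl⟩ ⟨g', f', hf', hfg', hp⟩
  obtain ⟨a, b, m, m', hma, hmb, hma', hmb'⟩ := exists_pairing_step h₁ h₂ hc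
  rw [coxPoint_swap h₂] at hp
  have e1 := congr_arg (fun q => q (Δ.chi k m)) hp
  have e2 := congr_arg (fun q => q (Δ.chi k m')) hp
  simp only [coxPoint_chi _ _ _ _ _ _ hma hmb, coxPoint_chi _ _ _ _ _ _ hma' hmb',
    MonoidHom.one_apply, one_mul] at e1 e2
  have e1' : |f| ^ (a + 1) * |g| ^ b = |f'| ^ (a + 1) * |g'| ^ b := by
    simp only [← abs_pow, ← abs_mul]; congr 1; exact_mod_cast e1
  have e2' : |f| ^ a * |g| ^ (b + c) = |f'| ^ a * |g'| ^ (b + c) := by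
    simp only [← abs_pow, ← abs_mul]; congr 1; exact_mod_cast e2
  have hg0 : 0 < |g| := abs_pos.2 hg
  have hf0 : 0 < |f| := hg0.trans hfg
  have hf'0 : 0 < |f'| := abs_pos.2 hf'
  have hg'0 : 0 < |g'| := hf'0.trans hfg'
  generalize |f| = F at *
  generalize |g| = G at *
  generalize |f'| = F' at *
  generalize |g'| = G' at *
  -- The quotient of the two characters is `F / G ^ c`.
  have e3 : F * G' ^ c = F' * G ^ c := by
    have hpos : (F ^ a * F' ^ a * G ^ b * G' ^ b) ≠ 0 := by positivity
    refine mul_left_cancel₀ hpos ?_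
    calc F ^ a * F' ^ a * G ^ b * G' ^ b * (F * G' ^ c)
        = (F ^ (a + 1) * G ^ b) * (F' ^ a * G' ^ (b + c)) := by ring
      _ = (F' ^ (a + 1) * G' ^ b) * (F ^ a * G ^ (b + c)) := by rw [e1', e2']
      _ = _ := by ring
  -- Eliminate `F`; the exponent is the determinant `(a + 1)(b + c) - ab`, which is positive.
  have e4 : G' ^ (c * (a + 1) + b) = G ^ (c * (a + 1) + b) := by
    have hpos : (F ^ (a + 1) * F' ^ (a + 1)) ≠ 0 := by positivity
    refine mul_left_cancel₀ hpos ?_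
    calc F ^ (a + 1) * F' ^ (a + 1) * G' ^ (c * (a + 1) + b)
        = (F * G' ^ c) ^ (a + 1) * (F' ^ (a + 1) * G' ^ b) := by ring
      _ = (F' * G ^ c) ^ (a + 1) * (F ^ (a + 1) * G ^ b) := by rw [e3, e1']
      _ = _ := by ring
  have e5 : G' = G := (pow_left_inj₀ hg'0.le hg0.le (by positivity)).1 e4
  subst e5
  have e6 : F = F' := mul_right_cancel₀ (pow_pos hg0 c).ne' e3
  omega

theorem containsFreeGroupOfRankTwo_of_pairing_ne_zero (h₁ : Δ.IsDemazureRoot ρ₁ e₁)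
    (h₂ : Δ.IsDemazureRoot ρ₂ e₂) {c d : ℕ} (hc : ρ₂ ⬝ᵥ e₁ = c) (hd : ρ₁ ⬝ᵥ e₂ = d)
    (hc0 : c ≠ 0) (hd0 : d ≠ 0) :
    ContainsFreeGroupOfRankTwo ↥(rootSubgroup k h₁ ⊔ rootSubgroup k h₂) := by
  let _ := AlgEquiv.pointAction k (Δ.CoordRing k) k
  let g : Fin 2 → ↥(rootSubgroup k h₁ ⊔ rootSubgroup k h₂) :=
    ![⟨_, Subgroup.mem_sup_left (expAut_mem_expSubgroup _ _ 2)⟩,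
      ⟨_, Subgroup.mem_sup_right (expAut_mem_expSubgroup _ _ 2)⟩]
  refine containsFreeGroupOfRankTwo_of_ping_pong g
    ![pingSet k h₁.isRayGenerator h₂.isRayGenerator,
      pingSet k h₂.isRayGenerator h₁.isRayGenerator] ?_ (disjoint_pingSet h₁ _ hc hc0) ?_
  · intro i
    fin_cases i
    · exact ⟨_, 2, 1, one_ne_zero, by norm_num, rfl⟩
    · exact ⟨_, 2, 1, one_ne_zero, by norm_num, rfl⟩
  -- Points are moved by the inverse automorphism, which only replaces `n` by `-n`.
  · have hz : ∀ {ρ e : Fin n → ℤ} (h : Δ.IsDemazureRoot ρ e) (n : ℤ),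
        (expAut (rootDerivation k h) (rootDerivation_isLocallyNilpotent k h) 2 ^ n)⁻¹ =
        expAut (rootDerivation k h) (rootDerivation_isLocallyNilpotent k h) ((-n : ℤ) * 2) :=
      fun h n => by rw [← zpow_neg, expAut_zpow]
    intro i j hij n hn p hp
    fin_cases i <;> fin_cases j
    · exact absurd rfl hij
    · have := comp_expAut_mem_pingSet h₁ h₂.isRayGenerator hc hc0 (neg_ne_zero.2 hn) hp
      rw [← hz] at this
      exact this
    · have := comp_expAut_mem_pingSet h₂ h₁.isRayGenerator hd hd0 (neg_ne_zero.2 hn) hp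
      rw [← hz] at this
      exact this
    · exact absurd rfl hij

/-! ## Two root subgroups with nonzero pairings do not generate a unipotent group -/

/-- The product `exp (s ∂₁) exp (s ∂₂)` in Cox coordinates. -/
def coxStep (s c d : ℕ) (x : ℕ × ℕ) : ℕ × ℕ :=
  (x.1 + s * x.2 ^ c, x.2 + s * (x.1 + s * x.2 ^ c) ^ d)

/-- The second coordinate is updated last, by at least the new first one, so the order `x ≤ y`
persists along the orbit of `(1, 1)`. -/
theorem coxStep_iterate_le {s c d : ℕ} (hs : 0 < s) (hd : d ≠ 0) (j : ℕ) :
    0 < ((coxStep s c d)^[j] (1, 1)).1 ∧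
      ((coxStep s c d)^[j] (1, 1)).1 ≤ ((coxStep s c d)^[j] (1, 1)).2 := by
  induction j with
  | zero => simp
  | succ j ih =>
    rw [Function.iterate_succ_apply']
    generalize (coxStep s c d)^[j] (1, 1) = x at ih
    simp only [coxStep]
    refine ⟨by omega, ?_⟩
    have h1 := Nat.le_self_pow hd (x.1 + s * x.2 ^ c)
    have h2 := Nat.le_mul_of_pos_left ((x.1 + s * x.2 ^ c) ^ d) hs
    omega

/-- On `x ≤ y` the new first coordinate is at least `s y^c ≥ s x`, and the second does not decrease.
The positive exponent `a + 1` is essential. -/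
theorem mul_le_coxStep {s c d : ℕ} (hc : c ≠ 0) (a b : ℕ) {x : ℕ × ℕ}
    (h : x.1 ≤ x.2) :
    s * (x.1 ^ (a + 1) * x.2 ^ b) ≤
      (coxStep s c d x).1 ^ (a + 1) * (coxStep s c d x).2 ^ b := by
  have h1 : s * x.1 ≤ (coxStep s c d x).1 :=
    (Nat.mul_le_mul_left s (h.trans (Nat.le_self_pow hc _))).trans (Nat.le_add_left _ _)
  have h2 : x.2 ≤ (coxStep s c d x).2 := Nat.le_add_right _ _
  calc s * (x.1 ^ (a + 1) * x.2 ^ b) ≤ s ^ (a + 1) * (x.1 ^ (a + 1) * x.2 ^ b) := by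
        gcongr
        exact Nat.le_self_pow a.succ_ne_zero s
    _ = (s * x.1) ^ (a + 1) * x.2 ^ b := by ring
    _ ≤ _ := by gcongr

/-- A sequence that grows by a factor larger than `2 ^ N` in every step is not annihilated by the
`N`-th finite difference. -/
theorem sum_choose_ne_zero_of_growth {N s : ℕ} (hs : 2 ^ N < s) (z : ℕ → ℕ) (hz : 0 < z N)
    (hgrow : ∀ j, s * z j ≤ z (j + 1)) :
    ∑ j ∈ Finset.range (N + 1), ((-1) ^ (N - j) * (N.choose j : ℤ)) * (z j : ℤ) ≠ 0 := by
  intro h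
  have hs0 : 0 < s := (Nat.zero_le _).trans_lt hs
  have hmono : Monotone z := monotone_nat_of_le_succ fun j =>
    (Nat.le_mul_of_pos_left _ hs0).trans (hgrow j)
  rw [Finset.sum_range_succ, Nat.sub_self, pow_zero, Nat.choose_self, Nat.cast_one, one_mul,
    one_mul, add_eq_zero_iff_neg_eq] at h
  have h1 : (z N : ℤ) ≤ ∑ j ∈ Finset.range N, (N.choose j : ℤ) * (z j : ℤ) := by
    rw [← h, ← Finset.sum_neg_distrib]
    refine Finset.sum_le_sum fun j _ => ?_
    rw [← neg_mul]
    refine mul_le_mul_of_nonneg_right ?_ (by positivity)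
    rcases neg_one_pow_eq_or ℤ (N - j) with h | h <;> rw [h] <;> simp
  have h2 : z N ≤ ∑ j ∈ Finset.range N, N.choose j * z j := by exact_mod_cast h1
  -- Multiplying by `s` allows each `s * z j` to be replaced by `z (j + 1) ≤ z N`.
  have h3 : s * z N ≤ 2 ^ N * z N := by
    calc s * z N ≤ s * ∑ j ∈ Finset.range N, N.choose j * z j := Nat.mul_le_mul_left s h2
      _ = ∑ j ∈ Finset.range N, N.choose j * (s * z j) := by
        rw [Finset.mul_sum]
        exact Finset.sum_congr rfl fun j _ => by ring
      _ ≤ ∑ j ∈ Finset.range N, N.choose j * z N := Finset.sum_le_sum fun j hj =>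
        Nat.mul_le_mul_left _ ((hgrow j).trans (hmono (Finset.mem_range.1 hj)))
      _ ≤ ∑ j ∈ Finset.range (N + 1), N.choose j * z N :=
        Finset.sum_le_sum_of_subset (Finset.range_mono N.le_succ)
      _ = 2 ^ N * z N := by rw [← Finset.sum_mul, Nat.sum_range_choose]
  exact absurd (Nat.le_of_mul_le_mul_right h3 hz) hs.not_ge

/-- The automorphisms are pullbacks, so the left factor `exp (s ∂₁)` moves the point first. -/
theorem exists_mem_coxPoint_coxStep (h₁ : Δ.IsDemazureRoot ρ₁ e₁)
    (h₂ : Δ.IsDemazureRoot ρ₂ e₂) {c d : ℕ} (hc : ρ₂ ⬝ᵥ e₁ = c) (hd : ρ₁ ⬝ᵥ e₂ = d) (s : ℕ) :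
    ∃ h ∈ rootSubgroup k h₁ ⊔ rootSubgroup k h₂, ∀ (y : ℕ × ℕ) (x : Δ.CoordRing k),
      coxPoint k h₁.isRayGenerator h₂.isRayGenerator 1 (y.1 : k) (y.2 : k) (h x) =
        coxPoint k h₁.isRayGenerator h₂.isRayGenerator 1
          ((coxStep s c d y).1 : k) ((coxStep s c d y).2 : k) x := by
  refine ⟨_, mul_mem (Subgroup.mem_sup_left (expAut_mem_expSubgroup _ _ (s : k)))
    (Subgroup.mem_sup_right (expAut_mem_expSubgroup _ _ (s : k))), fun y x => ?_⟩
  rw [AlgEquiv.mul_apply, coxPoint_expAut_apply h₁ _ hc, coxPoint_swap,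
    coxPoint_expAut_apply h₂ _ hd, coxPoint_swap]
  simp [coxStep]

theorem not_isUnipotentAlgebraicGroup_of_pairing_ne_zero (h₁ : Δ.IsDemazureRoot ρ₁ e₁)
    (h₂ : Δ.IsDemazureRoot ρ₂ e₂) {c d : ℕ} (hc : ρ₂ ⬝ᵥ e₁ = c) (hd : ρ₁ ⬝ᵥ e₂ = d)
    (hc0 : c ≠ 0) (hd0 : d ≠ 0) :
    ¬ IsUnipotentAlgebraicGroup (rootSubgroup k h₁ ⊔ rootSubgroup k h₂) := by
  intro hH
  obtain ⟨a, b, m, -, hma, hmb, -, -⟩ := exists_pairing_step h₁ h₂.isRayGenerator hc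
  obtain ⟨N, hN⟩ := hH.exists_sum_pow_eq_zero (Δ.chi k m)
  -- `N` is uniform in the group element, so `s`, and with it `h`, may be chosen after `N`.
  obtain ⟨s, hs⟩ : ∃ s : ℕ, 2 ^ N < s := ⟨_, Nat.lt_succ_self _⟩
  have hs0 : 0 < s := (Nat.zero_le _).trans_lt hs
  obtain ⟨h, hh, hstep⟩ := exists_mem_coxPoint_coxStep (k := k) h₁ h₂ hc hd s
  have hiter : ∀ (j : ℕ) (x : Δ.CoordRing k),
      coxPoint k h₁.isRayGenerator h₂.isRayGenerator 1
          ((((1, 1) : ℕ × ℕ).1 : ℕ) : k) ((((1, 1) : ℕ × ℕ).2 : ℕ) : k) ((h ^ j) x) =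
        coxPoint k h₁.isRayGenerator h₂.isRayGenerator 1
          (((coxStep s c d)^[j] (1, 1)).1 : k) (((coxStep s c d)^[j] (1, 1)).2 : k) x := by
    intro j
    induction j with
    | zero => intro x; rfl
    | succ j ih =>
      intro x
      rw [pow_succ, AlgEquiv.mul_apply, ih, hstep, Function.iterate_succ_apply']
  have hsum := congr_arg (coxPoint k h₁.isRayGenerator h₂.isRayGenerator 1
    ((((1, 1) : ℕ × ℕ).1 : ℕ) : k) ((((1, 1) : ℕ × ℕ).2 : ℕ) : k)) (hN h hh)
  rw [map_sum, map_zero] at hsum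
  simp_rw [map_zsmul, hiter, coxPoint_chi _ _ _ _ _ _ hma hmb, zsmul_eq_mul,
    MonoidHom.one_apply, one_mul] at hsum
  have hpos := coxStep_iterate_le (s := s) (c := c) hs0 hd0
  refine sum_choose_ne_zero_of_growth hs (fun j => ((coxStep s c d)^[j] (1, 1)).1 ^ (a + 1) *
    ((coxStep s c d)^[j] (1, 1)).2 ^ b) ?_ ?_ (by exact_mod_cast hsum)
  · exact Nat.mul_pos (pow_pos (hpos N).1 _) (pow_pos ((hpos N).1.trans_le (hpos N).2) _)
  · intro j
    have := mul_le_coxStep (d := d) hc0 a b (s := s) (hpos j).2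
    simp only [Function.iterate_succ_apply']
    exact this

end ToricCone

section Triangular

open Polynomial

/-! ## The group of triangular transformations `(x, y) ↦ (x + Q(y), y + t)` -/

/-- The triangular transformation `(x, y) ↦ (x + Q(y), y + t)` of the plane. -/
@[ext]
structure TriangularShift (k : Type*) [Field k] where
  /-- the translation `t` of the second coordinate -/
  shift : k
  /-- the polynomial `Q` -/
  poly : k[X]

namespace TriangularShift

variable {k : Type*} [Field k]

/-- In `γ * δ` the transformation `γ` acts first, in agreement with the product of pullbacks. -/
noncomputable instance : Mul (TriangularShift k) :=
  ⟨fun γ δ => ⟨γ.shift + δ.shift, γ.poly + taylor γ.shift δ.poly⟩⟩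

noncomputable instance : One (TriangularShift k) := ⟨⟨0, 0⟩⟩

noncomputable instance : Inv (TriangularShift k) := ⟨fun γ => ⟨-γ.shift, -taylor (-γ.shift) γ.poly⟩⟩

@[simp] theorem mul_shift (γ δ : TriangularShift k) : (γ * δ).shift = γ.shift + δ.shift := rfl

@[simp] theorem mul_poly (γ δ : TriangularShift k) :
    (γ * δ).poly = γ.poly + taylor γ.shift δ.poly := rfl

@[simp] theorem one_shift : (1 : TriangularShift k).shift = 0 := rfl

@[simp] theorem one_poly : (1 : TriangularShift k).poly = 0 := rfl

@[simp] theorem inv_shift (γ : TriangularShift k) : γ⁻¹.shift = -γ.shift := rfl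

@[simp] theorem inv_poly (γ : TriangularShift k) : γ⁻¹.poly = -taylor (-γ.shift) γ.poly := rfl

noncomputable instance : Group (TriangularShift k) :=
  Group.ofLeftAxioms
    (fun a b c => by ext1 <;> simp [add_assoc, taylor_taylor])
    (fun a => by ext1 <;> simp)
    (fun a => by ext1 <;> simp)

theorem commute_of_shift_eq_zero {γ δ : TriangularShift k} (hγ : γ.shift = 0) (hδ : δ.shift = 0) :
    γ * δ = δ * γ := by
  ext1 <;> simp [hγ, hδ, add_comm]

theorem commutator_shift (γ δ : TriangularShift k) : (γ * δ * γ⁻¹ * δ⁻¹).shift = 0 := by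
  simp

/-- A metabelian group contains no free subgroup of rank two. -/
theorem not_containsFreeGroupOfRankTwo : ¬ ContainsFreeGroupOfRankTwo (TriangularShift k) := by
  rintro ⟨f, hf⟩
  let a : FreeGroup (Fin 2) := FreeGroup.of 0
  let b : FreeGroup (Fin 2) := FreeGroup.of 1
  -- The commutators `[a, b]` and `[a⁻¹, b]` map to elements with zero shift, which commute, whereas
  -- they do not commute in the free group.
  have h : (a * b * a⁻¹ * b⁻¹) * (a⁻¹ * b * a⁻¹⁻¹ * b⁻¹) =
      (a⁻¹ * b * a⁻¹⁻¹ * b⁻¹) * (a * b * a⁻¹ * b⁻¹) := by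
    apply hf
    simp only [map_mul _ (a * b * a⁻¹ * b⁻¹), map_mul _ (a⁻¹ * b * a⁻¹⁻¹ * b⁻¹)]
    refine commute_of_shift_eq_zero ?_ ?_
    · simp only [map_mul, map_inv]
      exact commutator_shift _ _
    · simp only [map_mul, map_inv f a⁻¹, map_inv f b]
      exact commutator_shift _ _
  revert h
  decide

/-- The subgroup of transformations with `deg Q ≤ c`. -/
def bounded (k : Type*) [Field k] (c : ℕ) : Subgroup (TriangularShift k) where
  carrier := {γ | γ.poly.natDegree ≤ c}
  mul_mem' {a b} ha hb := natDegree_add_le_of_degree_le ha (by rwa [natDegree_taylor])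
  one_mem' := by simp
  inv_mem' {a} ha := by
    change (-taylor _ _).natDegree ≤ c
    rwa [natDegree_neg, natDegree_taylor]

theorem natDegree_poly_le {c : ℕ} (γ : bounded k c) : (γ : TriangularShift k).poly.natDegree ≤ c :=
  γ.2

/-! ### A faithful linear representation -/

/-- Substituting `y + t` for `y` as a matrix acting on coefficient vectors; it computes both kinds
of columns in `matrix_mul`. -/
theorem sum_coeff_X_add_C_pow_mul (t : k) (P : k[X]) {N : ℕ} (hP : P.natDegree < N) (i : ℕ) :
    ∑ l : Fin N, ((X + C t) ^ (l : ℕ)).coeff i * P.coeff l = (taylor t P).coeff i := by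
  rw [Fin.sum_univ_eq_sum_range fun l : ℕ => ((X + C t : k[X]) ^ l).coeff i * P.coeff l]
  conv_rhs => rw [P.as_sum_range' N hP, map_sum, finsetSum_coeff]
  refine Finset.sum_congr rfl fun l _ => ?_
  rw [taylor_monomial, coeff_C_mul, mul_comm]

/-- The matrix of the action on the span of `1, y, …, y ^ (c + 1), x`. -/
noncomputable def matrix (c : ℕ) (γ : TriangularShift k) :
    Matrix (Fin (c + 3)) (Fin (c + 3)) k := Matrix.of fun i j =>
  if j = Fin.last (c + 2) then (if i = Fin.last (c + 2) then 1 else γ.poly.coeff i)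
  else ((X + C γ.shift) ^ (j : ℕ)).coeff i

theorem matrix_castSucc (c : ℕ) (γ : TriangularShift k) (i : Fin (c + 3)) (j : Fin (c + 2)) :
    matrix c γ i j.castSucc = ((X + C γ.shift) ^ (j : ℕ)).coeff i := by
  simp [matrix, (Fin.castSucc_lt_last j).ne]

theorem matrix_last (c : ℕ) (γ : TriangularShift k) (i : Fin (c + 3)) :
    matrix c γ i (Fin.last _) = if i = Fin.last (c + 2) then 1 else γ.poly.coeff i := by
  simp [matrix]

/-- Monomials up to `y ^ (c + 1)`, not just `y ^ c`, are included so that `t` is a matrix entry even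
for `c = 0`. -/
theorem matrix_zero_one (c : ℕ) (γ : TriangularShift k) : matrix c γ 0 1 = γ.shift := by
  have := matrix_castSucc c γ 0 1
  simpa using this

theorem matrix_one (c : ℕ) : matrix c (1 : TriangularShift k) = 1 := by
  ext i j
  rw [Matrix.one_apply]
  induction j using Fin.lastCases with
  | last => rw [matrix_last]; simp
  | cast j => rw [matrix_castSucc]; simp [coeff_X_pow, Fin.ext_iff]

theorem matrix_mul {c : ℕ} (γ : TriangularShift k) {δ : TriangularShift k}
    (hδ : δ.poly.natDegree ≤ c) : matrix c (γ * δ) = matrix c γ * matrix c δ := by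
  ext i j
  rw [Matrix.mul_apply, Fin.sum_univ_castSucc]
  simp_rw [matrix_castSucc]
  induction j using Fin.lastCases with
  | last =>
    have h1 : ∀ l : Fin (c + 2), matrix c δ l.castSucc (Fin.last _) = δ.poly.coeff l := fun l => by
      simp [matrix_last, (Fin.castSucc_lt_last l).ne]
    simp_rw [h1]
    rw [sum_coeff_X_add_C_pow_mul _ _ (by omega)]
    simp only [matrix_last, if_true, mul_one, mul_poly]
    split_ifs with h
    · rw [coeff_eq_zero_of_natDegree_lt, zero_add]
      rw [natDegree_taylor, h, Fin.val_last]
      omega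
    · rw [coeff_add, add_comm]
  | cast j =>
    have h2 : ∀ l : Fin (c + 3), matrix c δ l j.castSucc = ((X + C δ.shift) ^ (j : ℕ)).coeff l :=
      fun l => matrix_castSucc c δ l j
    have hdeg : ((X + C δ.shift) ^ (j : ℕ)).natDegree < c + 2 := by
      rw [natDegree_pow, natDegree_X_add_C, mul_one]
      exact j.2
    simp_rw [h2]
    rw [matrix_castSucc]
    simp only [Fin.val_castSucc, Fin.val_last]
    rw [sum_coeff_X_add_C_pow_mul _ _ hdeg, coeff_eq_zero_of_natDegree_lt hdeg, mul_zero, add_zero,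
      taylor_pow, map_add, taylor_X, taylor_C, mul_shift, C_add, add_assoc]

/-- The representation on the span of `1, y, …, y ^ (c + 1), x`. -/
noncomputable def rep (k : Type*) [Field k] (c : ℕ) : bounded k c →* GL (Fin (c + 3)) k :=
  MonoidHom.toHomUnits
    { toFun := fun γ => matrix c (γ : TriangularShift k)
      map_one' := matrix_one c
      map_mul' := fun γ δ => matrix_mul (γ : TriangularShift k) (natDegree_poly_le δ) }

theorem coe_rep (c : ℕ) (γ : bounded k c) :
    (rep k c γ : Matrix (Fin (c + 3)) (Fin (c + 3)) k) = matrix c (γ : TriangularShift k) := rfl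

theorem ext_of_matrix {c : ℕ} {γ δ : TriangularShift k} (hγ : γ.poly.natDegree ≤ c)
    (hδ : δ.poly.natDegree ≤ c) (h : matrix c γ = matrix c δ) : γ = δ := by
  ext1
  · rw [← matrix_zero_one c γ, h, matrix_zero_one]
  · ext i
    rcases lt_or_ge i (c + 2) with hi | hi
    · have h1 := congr_fun (congr_fun h (Fin.castSucc ⟨i, hi⟩)) (Fin.last _)
      rwa [matrix_last, matrix_last, if_neg (Fin.castSucc_lt_last _).ne,
        if_neg (Fin.castSucc_lt_last _).ne] at h1
    · rw [coeff_eq_zero_of_natDegree_lt (by omega), coeff_eq_zero_of_natDegree_lt (by omega)]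

theorem rep_injective (c : ℕ) : Function.Injective (rep k c) := fun γ δ h =>
  Subtype.ext (ext_of_matrix (natDegree_poly_le γ) (natDegree_poly_le δ) (congr_arg Units.val h))

/-- The matrix is upper triangular with ones on the diagonal, so Cayley–Hamilton applies to `(X - 1)
^ (c + 3)`. -/
theorem isNilpotent_matrix_sub_one (c : ℕ) (γ : TriangularShift k) :
    IsNilpotent (matrix c γ - 1) := by
  have hdiag : ∀ i, matrix c γ i i = 1 := by
    intro i
    induction i using Fin.lastCases with
    | last => simp [matrix_last]
    | cast i => rw [matrix_castSucc]; simp [coeff_X_add_C_pow]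
  have htri : (matrix c γ).IsUpperTriangular := by
    intro i j hij
    change j < i at hij
    induction j using Fin.lastCases with
    | last => exact absurd hij (Fin.le_last i).not_gt
    | cast j =>
      rw [matrix_castSucc, coeff_X_add_C_pow,
        Nat.choose_eq_zero_of_lt (show (j : ℕ) < i from Fin.lt_def.1 hij), Nat.cast_zero, mul_zero]
  have h := (matrix c γ).aeval_self_charpoly
  rw [Matrix.charpoly_of_isUpperTriangular _ htri] at h
  simp only [hdiag, Finset.prod_const, map_pow, map_sub, aeval_X, map_one] at h
  exact ⟨_, h⟩

/-- The equations of the image of `rep`. -/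
noncomputable def repEquation (k : Type*) [Field k] (c : ℕ) (i j : Fin (c + 3)) :
    MvPolynomial (Fin (c + 3) × Fin (c + 3)) k :=
  if j = Fin.last (c + 2) then
    (if i = Fin.last (c + 2) then .X (i, j) - 1 else if (i : ℕ) ≤ c then 0 else .X (i, j))
  -- For `i > j` the binomial coefficient vanishes, so the truncated subtraction is harmless.
  else .X (i, j) - .X (0, 1) ^ ((j : ℕ) - i) * .C ((j : ℕ).choose i : k)

/-- Entry `(0, 1)` determines all columns but the last, whose rows `0, …, c` are free. Conversely,
`t` and `Q` are read off from these entries. -/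
theorem isUnipotentLinearAlgebraic_range_rep (c : ℕ) :
    IsUnipotentLinearAlgebraic (rep k c).range where
  closed := by
    refine ⟨Set.range fun ij : Fin (c + 3) × Fin (c + 3) => repEquation k c ij.1 ij.2,
      fun g => ?_⟩
    rw [Set.forall_mem_range, Prod.forall]
    constructor
    · rintro ⟨γ, rfl⟩ i j
      rw [evalEntries, coe_rep, repEquation]
      induction j using Fin.lastCases with
      | last =>
        rw [if_pos rfl]
        split_ifs with h1 h2
        · simp [matrix_last, show i = Fin.last (c + 2) from h1]
        · simp
        · simp only [MvPolynomial.eval_X, matrix_last, if_neg h1]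
          exact coeff_eq_zero_of_natDegree_lt ((natDegree_poly_le γ).trans_lt (not_le.1 h2))
      | cast j =>
        rw [if_neg (Fin.castSucc_lt_last j).ne]
        simp [matrix_castSucc, matrix_zero_one, coeff_X_add_C_pow]
    · intro h
      let q : ℕ → k := fun i => if hi : i < c + 3 then g.1 ⟨i, hi⟩ (Fin.last _) else 0
      let Q : k[X] := ∑ i ∈ Finset.range (c + 1), monomial i (q i)
      have hQ : Q.natDegree ≤ c := natDegree_sum_le_of_forall_le _ _ fun i hi =>
        (natDegree_monomial_le _).trans (Nat.lt_succ_iff.1 (Finset.mem_range.1 hi))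
      have hcoeff : ∀ i : Fin (c + 3), (i : ℕ) ≤ c → Q.coeff i = g.1 i (Fin.last _) := by
        intro i hi
        simp only [Q, finsetSum_coeff, coeff_monomial]
        rw [Finset.sum_ite_eq' , if_pos (Finset.mem_range.2 (Nat.lt_succ_of_le hi))]
        simp [q]
      refine ⟨⟨⟨g.1 0 1, Q⟩, hQ⟩, Units.ext ?_⟩
      ext i j
      rw [coe_rep]
      have hij := h i j
      rw [evalEntries, repEquation] at hij
      induction j using Fin.lastCases with
      | last =>
        rw [if_pos rfl] at hij
        rw [matrix_last]
        split_ifs at hij ⊢ with h1 h2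
        · rw [map_sub, map_one, MvPolynomial.eval_X, sub_eq_zero] at hij
          exact hij.symm
        · exact hcoeff i h2
        · rw [MvPolynomial.eval_X] at hij
          refine Eq.trans ?_ hij.symm
          exact coeff_eq_zero_of_natDegree_lt (hQ.trans_lt (not_le.1 h2))
      | cast j =>
        rw [if_neg (Fin.castSucc_lt_last j).ne] at hij
        rw [matrix_castSucc, coeff_X_add_C_pow]
        simp only [map_sub, map_mul, map_pow, MvPolynomial.eval_X, MvPolynomial.eval_C,
          sub_eq_zero] at hij
        exact hij.symm
  unipotent := by
    rintro _ ⟨γ, rfl⟩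
    exact isNilpotent_matrix_sub_one c _

end TriangularShift

/-- The translates of `X ^ c` span the polynomials of degree at most `c`. -/
theorem Polynomial.mem_of_forall_X_add_C_pow_mem {k : Type*} [Field k] [CharZero k] {c : ℕ}
    {S : Submodule k k[X]} (hS : ∀ t : k, (X + C t) ^ c ∈ S) {Q : k[X]} (hQ : Q.natDegree ≤ c) :
    Q ∈ S := by
  have hX : ∀ i ≤ c, (X ^ i : k[X]) ∈ S := by
    intro i hi
    by_contra hiS
    obtain ⟨l, hl, hSl⟩ := Submodule.exists_le_ker_of_notMem hiS
    -- `p(t) = l ((X + t) ^ c)` vanishes for all `t` in an infinite field, so its coefficients `l (X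
    -- ^ m) * c.choose m` vanish too.
    let p : k[X] := ∑ m ∈ Finset.range (c + 1), monomial (c - m) (l (X ^ m) * (c.choose m : k))
    have hp : p = 0 := by
      refine Polynomial.funext fun t => ?_
      have h := LinearMap.mem_ker.1 (hSl (hS t))
      rw [add_pow, map_sum] at h
      rw [eval_zero, ← h, eval_finsetSum]
      refine Finset.sum_congr rfl fun m _ => ?_
      have : (X ^ m * C t ^ (c - m) * (c.choose m : k[X]) : k[X]) =
          (t ^ (c - m) * (c.choose m : k)) • X ^ m := by
        rw [smul_eq_C_mul, C_mul, C_pow, C_eq_natCast]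
        ring
      rw [this, map_smul, eval_monomial, smul_eq_mul]
      ring
    have h2 : p.coeff (c - i) = l (X ^ i) * (c.choose i : k) := by
      simp only [p, finsetSum_coeff, coeff_monomial]
      rw [Finset.sum_eq_single i]
      · simp
      · intro m hm hmi
        rw [if_neg]
        have := Finset.mem_range.1 hm
        omega
      · intro h
        exact absurd (Finset.mem_range.2 (Nat.lt_succ_of_le hi)) h
    rw [hp, coeff_zero, eq_comm, mul_eq_zero] at h2
    exact h2.elim hl (Nat.cast_ne_zero.2 (Nat.choose_pos hi).ne')
  rw [Q.as_sum_range' (c + 1) (Nat.lt_succ_of_le hQ)]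
  refine Submodule.sum_mem _ fun i hi => ?_
  rw [← C_mul_X_pow_eq_monomial, ← smul_eq_C_mul]
  exact S.smul_mem _ (hX i (Nat.lt_succ_iff.1 (Finset.mem_range.1 hi)))

/-! ## Recognizing unipotent algebraic groups -/

section Recognition

variable {k : Type*} [Field k] {A : Type*} [CommRing A] [Algebra k A]

theorem isUnipotentAlgebraicGroup_of_injective {Γ : Type*} [Group Γ] {r : ℕ}
    (β : Γ →* GL (Fin r) k) (hβ : Function.Injective β) (hβr : IsUnipotentLinearAlgebraic β.range)
    (α : Γ →* (A ≃ₐ[k] A)) (hα : Function.Injective α)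
    (hreg : ∀ f : A, ∃ (d : ℕ) (a : Fin d → A) (p : Fin d → MvPolynomial (Fin r × Fin r) k),
      ∀ γ : Γ, α γ f = ∑ i, evalEntries (p i) (β γ) • a i) :
    IsUnipotentAlgebraicGroup α.range := by
  refine ⟨r, β.range, (MonoidHom.ofInjective hβ).symm.trans (MonoidHom.ofInjective hα), hβr,
    fun f => ?_⟩
  obtain ⟨d, a, p, h⟩ := hreg f
  refine ⟨d, a, p, fun g => ?_⟩
  obtain ⟨γ, rfl⟩ := (MonoidHom.ofInjective hβ).surjective g
  rw [MulEquiv.trans_apply, MulEquiv.symm_apply_apply]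
  exact h γ

/-- A family that becomes polynomial in the matrix entries after a linear embedding of `A` into an
algebra is polynomial in the matrix entries. -/
theorem exists_evalEntries_of_embedding {Γ L : Type*} [CommRing L] [Algebra k L] {r : ℕ}
    (β : Γ → GL (Fin r) k) (F : Γ → A) (ι : A →ₗ[k] L) (hι : Function.Injective ι)
    (P : MvPolynomial (Fin r × Fin r) L)
    (hP : ∀ γ, ι (F γ) = MvPolynomial.eval (fun ij => algebraMap k L ((β γ).1 ij.1 ij.2)) P) :
    ∃ (d : ℕ) (a : Fin d → A) (p : Fin d → MvPolynomial (Fin r × Fin r) k),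
      ∀ γ, F γ = ∑ i, evalEntries (p i) (β γ) • a i := by
  -- A merely linear retraction suffices: the matrix entries are scalars, and only the coefficients
  -- of `P` have to be brought back to `A`.
  obtain ⟨q, hq⟩ := LinearMap.exists_leftInverse_of_injective ι (LinearMap.ker_eq_bot.2 hι)
  let E := P.support.equivFin.symm
  refine ⟨_, fun i => q (P.coeff (E i)), fun i => MvPolynomial.monomial (E i : _ →₀ ℕ) 1,
    fun γ => ?_⟩
  have h1 : F γ = q (ι (F γ)) := (LinearMap.congr_fun hq (F γ)).symm
  rw [h1, hP, MvPolynomial.eval_eq', map_sum]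
  rw [← Finset.sum_coe_sort P.support, ← Equiv.sum_comp E]
  refine Finset.sum_congr rfl fun i _ => ?_
  rw [evalEntries, MvPolynomial.eval_monomial, one_mul, Finsupp.prod_fintype _ _ (by simp),
    ← map_smul, Algebra.smul_def, map_prod, mul_comm]
  simp only [map_pow]

theorem ContainsFreeGroupOfRankTwo.of_injective {G G' : Type*} [Group G] [Group G']
    (h : ContainsFreeGroupOfRankTwo G) (f : G →* G') (hf : Function.Injective f) :
    ContainsFreeGroupOfRankTwo G' := by
  obtain ⟨g, hg⟩ := h
  exact ⟨f.comp g, hf.comp hg⟩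

end Recognition

end Triangular

namespace ToricCone

open Polynomial

variable {n : ℕ} {Δ : ToricCone n} {k : Type u} [Field k] {ρ₁ ρ₂ e₁ e₂ : Fin n → ℤ}

/-! ## Two root subgroups with a vanishing pairing -/

/-- The automorphism `φ` acts in Cox coordinates as the homogenized triangular transformation
`(x, y) ↦ (x + Q(y), y + t)`. -/
def RepresentsShift (h₁ : Δ.IsRayGenerator ρ₁) (h₂ : Δ.IsRayGenerator ρ₂) (e₁ e₂ : Fin n → ℤ)
    (c : ℕ) (φ : Δ.CoordRing k ≃ₐ[k] Δ.CoordRing k) (γ : TriangularShift k) : Prop :=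
  ∀ (R : Type u) [CommRing R] [Algebra k R] (u : Multiplicative (Fin n → ℤ) →* R) (f g : R)
    (x : Δ.CoordRing k),
    coxPoint k h₁ h₂ u f g (φ x) = coxPoint k h₁ h₂ u
      (f + u (.ofAdd e₁) * u (.ofAdd e₂) ^ c * aeval (g * u (.ofAdd (-e₂))) γ.poly)
      (g + γ.shift • u (.ofAdd e₂)) x

theorem map_ofAdd_mul_neg {R : Type*} [CommRing R] (u : Multiplicative (Fin n → ℤ) →* R)
    (e : Fin n → ℤ) : u (.ofAdd e) * u (.ofAdd (-e)) = 1 := by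
  rw [← map_mul, ← ofAdd_add, add_neg_cancel, ofAdd_zero, map_one]

theorem RepresentsShift.one (h₁ : Δ.IsRayGenerator ρ₁) (h₂ : Δ.IsRayGenerator ρ₂) (c : ℕ) :
    RepresentsShift h₁ h₂ e₁ e₂ c (1 : Δ.CoordRing k ≃ₐ[k] Δ.CoordRing k) 1 := by
  intro R _ _ u f g x
  simp

/-- After `φ`, the argument `g * u(-e₂)` of `δ.poly` becomes `g * u(-e₂) + γ.shift`, which is
exactly the Taylor shift in the group law. -/
theorem RepresentsShift.mul {h₁ : Δ.IsRayGenerator ρ₁} {h₂ : Δ.IsRayGenerator ρ₂} {c : ℕ}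
    {φ ψ : Δ.CoordRing k ≃ₐ[k] Δ.CoordRing k} {γ δ : TriangularShift k}
    (hφ : RepresentsShift h₁ h₂ e₁ e₂ c φ γ) (hψ : RepresentsShift h₁ h₂ e₁ e₂ c ψ δ) :
    RepresentsShift h₁ h₂ e₁ e₂ c (φ * ψ) (γ * δ) := by
  intro R _ _ u f g x
  rw [AlgEquiv.mul_apply, hφ, hψ]
  congr 2
  · rw [add_assoc, ← mul_add, TriangularShift.mul_poly, map_add, taylor_apply, aeval_comp, add_mul,
      smul_mul_assoc, map_ofAdd_mul_neg, map_add, aeval_X, aeval_C, Algebra.algebraMap_eq_smul_one]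
  · rw [add_assoc, ← add_smul, TriangularShift.mul_shift]

/-- The embedding of `𝒪(X)` into the ring of Laurent polynomials. -/
theorem coxPoint_one_one_injective (h₁ : Δ.IsRayGenerator ρ₁) (h₂ : Δ.IsRayGenerator ρ₂) :
    Function.Injective (coxPoint k h₁ h₂ (AddMonoidAlgebra.of k (Fin n → ℤ)) 1 1) := by
  have h : coxPoint k h₁ h₂ (AddMonoidAlgebra.of k (Fin n → ℤ)) 1 1 =
      AddMonoidAlgebra.mapDomainAlgHom k k Δ.dualCone.subtype := by
    refine algHom_ext_chi fun m => ?_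
    obtain ⟨a, ha⟩ := exists_pairing_eq_nat h₁ m
    obtain ⟨b, hb⟩ := exists_pairing_eq_nat h₂ m
    rw [coxPoint_chi h₁ h₂ _ 1 1 m ha hb]
    simp [chi, AddMonoidAlgebra.mapDomain_single]
  rw [h]
  exact AddMonoidAlgebra.mapDomain_injective Subtype.val_injective

/-- Compare the two automorphisms at the generic point. -/
theorem RepresentsShift.unique {h₁ : Δ.IsRayGenerator ρ₁} {h₂ : Δ.IsRayGenerator ρ₂} {c : ℕ}
    {φ ψ : Δ.CoordRing k ≃ₐ[k] Δ.CoordRing k} {γ : TriangularShift k}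
    (hφ : RepresentsShift h₁ h₂ e₁ e₂ c φ γ) (hψ : RepresentsShift h₁ h₂ e₁ e₂ c ψ γ) :
    φ = ψ :=
  AlgEquiv.ext fun x => coxPoint_one_one_injective h₁ h₂ <| by rw [hφ, hψ]

theorem exists_pairing_sub (h₁ : Δ.IsDemazureRoot ρ₁ e₁) {c : ℕ}
    (hc : ρ₂ ⬝ᵥ e₁ = c) (m : Δ.dualCone) {a b : ℕ} (ha : ρ₁ ⬝ᵥ (m : Fin n → ℤ) = a)
    (hb : ρ₂ ⬝ᵥ (m : Fin n → ℤ) = b) {j : ℕ} (hj : j ≤ a) :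
    ∃ m' : Δ.dualCone, ρ₁ ⬝ᵥ (m' : Fin n → ℤ) = (a - j : ℕ) ∧
      ρ₂ ⬝ᵥ (m' : Fin n → ℤ) = (b + j * c : ℕ) := by
  -- Only `m' = m + j • e₁` in the dual cone is needed; the field is immaterial.
  obtain ⟨m', hm', -⟩ := exists_rootDerivation_pow_chi (k := ℚ) h₁ j a m ha hj
  refine ⟨m', ?_, ?_⟩
  · rw [hm', dotProduct_add, dotProduct_smul, h₁.pairing_self, ha]
    push_cast [hj]
    simp
    ring
  · rw [hm', dotProduct_add, dotProduct_smul, hb, hc]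
    simp

theorem RepresentsShift.eq_one [CharZero k] {h₁ : Δ.IsDemazureRoot ρ₁ e₁}
    {h₂ : Δ.IsRayGenerator ρ₂} {c : ℕ} (hc : ρ₂ ⬝ᵥ e₁ = c) {γ : TriangularShift k}
    (h : RepresentsShift h₁.isRayGenerator h₂ e₁ e₂ c (1 : Δ.CoordRing k ≃ₐ[k] Δ.CoordRing k) γ) :
    γ = 1 := by
  have key : ∀ (m : Δ.dualCone) {a b : ℕ}, ρ₁ ⬝ᵥ (m : Fin n → ℤ) = a →
      ρ₂ ⬝ᵥ (m : Fin n → ℤ) = b → ∀ f g : k,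
      f ^ a * g ^ b = (f + γ.poly.eval g) ^ a * (g + γ.shift) ^ b := by
    intro m a b ha hb f g
    have h1 := h k 1 f g (Δ.chi k m)
    rw [AlgEquiv.one_apply, coxPoint_chi _ _ _ _ _ _ ha hb, coxPoint_chi _ _ _ _ _ _ ha hb] at h1
    simpa using h1
  -- A character pairing to zero with `ρ₁` and positively with `ρ₂`, evaluated at `f = g = 0`, gives
  -- a positive power of the shift.
  have ht : γ.shift = 0 := by
    obtain ⟨m, hm⟩ := exists_pairing_pos h₂
    obtain ⟨a, ha⟩ := exists_pairing_eq_nat h₁.isRayGenerator m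
    obtain ⟨b, hb⟩ := exists_pairing_eq_nat h₂ m
    obtain ⟨m', ha', hb'⟩ := exists_pairing_sub h₁ hc m ha hb le_rfl
    have h2 := key m' ha' hb' 0 0
    have hb0 : b + a * c ≠ 0 := by omega
    rw [Nat.sub_self, pow_zero, pow_zero, one_mul, one_mul, zero_add, zero_pow hb0] at h2
    exact eq_zero_of_pow_eq_zero h2.symm
  -- A character pairing to one with `ρ₁` is linear in `f`; at `f = 0` it isolates `Q(g)` times a
  -- power of `g`.
  have hQ : γ.poly = 0 := by
    obtain ⟨a, b, m, -, ha, hb, -, -⟩ := exists_pairing_step h₁ h₂ hc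
    obtain ⟨m', ha', hb'⟩ := exists_pairing_sub h₁ hc m ha hb a.le_succ
    have h2 : γ.poly * X ^ (b + a * c) = 0 := Polynomial.funext fun g => by
      have h3 := key m' ha' hb' 0 g
      rw [ht, add_zero, zero_add, Nat.add_sub_cancel_left, pow_one, pow_one, zero_mul] at h3
      rw [eval_mul, eval_pow, eval_X, ← h3, eval_zero]
    exact (mul_eq_zero.1 h2).resolve_right (pow_ne_zero _ X_ne_zero)
  exact TriangularShift.ext ht hQ

/-- The triangular transformations of bounded degree act regularly. -/
theorem exists_mvPolynomial_coxPoint {h₁ : Δ.IsRayGenerator ρ₁} {h₂ : Δ.IsRayGenerator ρ₂} {c : ℕ}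
    {α : TriangularShift.bounded k c → (Δ.CoordRing k ≃ₐ[k] Δ.CoordRing k)}
    (hα : ∀ γ, RepresentsShift h₁ h₂ e₁ e₂ c (α γ) γ) (x : Δ.CoordRing k) :
    ∃ P : MvPolynomial (Fin (c + 3) × Fin (c + 3)) (AddMonoidAlgebra k (Fin n → ℤ)), ∀ γ,
      coxPoint k h₁ h₂ (AddMonoidAlgebra.of k (Fin n → ℤ)) 1 1 (α γ x) =
        MvPolynomial.eval (fun ij => algebraMap k _ ((TriangularShift.rep k c γ).1 ij.1 ij.2)) P := by
  set u := AddMonoidAlgebra.of k (Fin n → ℤ) with hu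
  induction x using AddMonoidAlgebra.induction_linear with
  | zero => exact ⟨0, fun γ => by rw [map_zero, map_zero, map_zero]⟩
  | add x y hx hy =>
    obtain ⟨P, hP⟩ := hx
    obtain ⟨Q, hQ⟩ := hy
    exact ⟨P + Q, fun γ => by rw [map_add, map_add, map_add, hP, hQ]⟩
  | single m s =>
    obtain ⟨a, ha⟩ := exists_pairing_eq_nat h₁ m
    obtain ⟨b, hb⟩ := exists_pairing_eq_nat h₂ m
    let T : MvPolynomial (Fin (c + 3) × Fin (c + 3)) (AddMonoidAlgebra k (Fin n → ℤ)) :=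
      ∑ i : Fin (c + 1), .X (i.castSucc.castSucc, Fin.last _) * .C (u (.ofAdd (-e₂)) ^ (i : ℕ))
    refine ⟨.C (s • u (.ofAdd (m : Fin n → ℤ))) *
      ((1 + .C (u (.ofAdd e₁) * u (.ofAdd e₂) ^ c) * T) ^ a *
        (1 + .X (0, 1) * .C (u (.ofAdd e₂))) ^ b), fun γ => ?_⟩
    have hT : MvPolynomial.eval (fun ij => algebraMap k _ ((TriangularShift.rep k c γ).1 ij.1 ij.2))
        T = aeval (u (.ofAdd (-e₂))) (γ : TriangularShift k).poly := by
      rw [aeval_eq_sum_range' (Nat.lt_succ_of_le (TriangularShift.natDegree_poly_le γ)),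
        map_sum, ← Fin.sum_univ_eq_sum_range
          (fun i => (γ : TriangularShift k).poly.coeff i • u (.ofAdd (-e₂)) ^ i)]
      refine Finset.sum_congr rfl fun i _ => ?_
      rw [map_mul, MvPolynomial.eval_X, MvPolynomial.eval_C, TriangularShift.coe_rep,
        TriangularShift.matrix_last, if_neg (Fin.castSucc_lt_last _).ne, Algebra.smul_def]
      rfl
    rw [TriangularShift.coe_rep] at hT
    have hs : (AddMonoidAlgebra.single m s : Δ.CoordRing k) = s • Δ.chi k m := by simp [chi]
    rw [hs, map_smul, map_smul, hα, coxPoint_chi _ _ _ _ _ _ ha hb]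
    simp only [map_mul, map_pow, map_add, map_one, MvPolynomial.eval_C, MvPolynomial.eval_X, hT,
      TriangularShift.coe_rep, TriangularShift.matrix_zero_one, one_mul, smul_mul_assoc,
      Algebra.smul_def ((γ : TriangularShift k).shift)]

variable [CharZero k]

theorem representsShift_expAut_left (h₁ : Δ.IsDemazureRoot ρ₁ e₁) (h₂ : Δ.IsRayGenerator ρ₂)
    {c : ℕ} (hc : ρ₂ ⬝ᵥ e₁ = c) (e₂ : Fin n → ℤ) (s : k) :
    RepresentsShift h₁.isRayGenerator h₂ e₁ e₂ c
      (expAut (rootDerivation k h₁) (rootDerivation_isLocallyNilpotent k h₁) s)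
      ⟨0, s • X ^ c⟩ := by
  intro R _ _ u f g x
  rw [coxPoint_expAut_apply h₁ h₂ hc]
  congr 2
  · rw [map_smul, map_pow, aeval_X, mul_smul_comm]
    congr 2
    calc u (.ofAdd e₁) * g ^ c
        = u (.ofAdd e₁) * (u (.ofAdd e₂) * u (.ofAdd (-e₂))) ^ c * g ^ c := by
          rw [map_ofAdd_mul_neg, one_pow, mul_one]
      _ = _ := by ring
  · rw [zero_smul, add_zero]

theorem representsShift_expAut_right (h₁ : Δ.IsRayGenerator ρ₁) (h₂ : Δ.IsDemazureRoot ρ₂ e₂)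
    (hd : ρ₁ ⬝ᵥ e₂ = 0) (e₁ : Fin n → ℤ) (c : ℕ) (t : k) :
    RepresentsShift h₁ h₂.isRayGenerator e₁ e₂ c
      (expAut (rootDerivation k h₂) (rootDerivation_isLocallyNilpotent k h₂) t) ⟨t, 0⟩ := by
  intro R _ _ u f g x
  rw [coxPoint_swap, coxPoint_expAut_apply h₂ h₁ (c := 0) (by simpa using hd), coxPoint_swap]
  simp

theorem exists_representsShift (h₁ : Δ.IsDemazureRoot ρ₁ e₁) (h₂ : Δ.IsDemazureRoot ρ₂ e₂) {c : ℕ}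
    (hc : ρ₂ ⬝ᵥ e₁ = c) (hd : ρ₁ ⬝ᵥ e₂ = 0) {γ : TriangularShift k}
    (hγ : γ.poly.natDegree ≤ c) :
    ∃ φ ∈ rootSubgroup k h₁ ⊔ rootSubgroup k h₂,
      RepresentsShift h₁.isRayGenerator h₂.isRayGenerator e₁ e₂ c φ γ := by
  have hright : ∀ t : k, ∃ φ ∈ rootSubgroup k h₁ ⊔ rootSubgroup k h₂,
      RepresentsShift h₁.isRayGenerator h₂.isRayGenerator e₁ e₂ c φ ⟨t, 0⟩ := fun t =>
    ⟨_, Subgroup.mem_sup_right (expAut_mem_expSubgroup _ _ t),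
      representsShift_expAut_right h₁.isRayGenerator h₂ hd e₁ c t⟩
  -- All multiples `s • Q` are demanded so that closure under scalars is immediate.
  let S : Submodule k k[X] :=
    { carrier := {Q | ∀ s : k, ∃ φ ∈ rootSubgroup k h₁ ⊔ rootSubgroup k h₂,
        RepresentsShift h₁.isRayGenerator h₂.isRayGenerator e₁ e₂ c φ ⟨0, s • Q⟩}
      zero_mem' := fun s => ⟨1, one_mem _, by
        rw [smul_zero]
        exact RepresentsShift.one _ _ c⟩
      add_mem' := by
        intro P Q hP hQ s
        obtain ⟨φ, hφ, hφ'⟩ := hP s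
        obtain ⟨ψ, hψ, hψ'⟩ := hQ s
        refine ⟨φ * ψ, mul_mem hφ hψ, ?_⟩
        convert hφ'.mul hψ' using 1
        ext1 <;> simp
      smul_mem' := by
        intro a Q hQ s
        rw [smul_smul]
        exact hQ _ }
  -- Conjugation by the translation `t` turns `s X^c` into `s (X + t)^c`.
  have hS : ∀ t : k, (X + C t) ^ c ∈ S := by
    intro t s
    obtain ⟨φ, hφ, hφ'⟩ := hright t
    obtain ⟨ψ, hψ, hψ'⟩ := hright (-t)
    refine ⟨_, mul_mem (mul_mem hφ (Subgroup.mem_sup_left (expAut_mem_expSubgroup _ _ s))) hψ, ?_⟩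
    convert (hφ'.mul (representsShift_expAut_left h₁ h₂.isRayGenerator hc e₂ s)).mul hψ' using 1
    ext1 <;> simp [taylor_pow, taylor_X]
  obtain ⟨φ, hφ, hφ'⟩ := Polynomial.mem_of_forall_X_add_C_pow_mem hS hγ 1
  obtain ⟨ψ, hψ, hψ'⟩ := hright γ.shift
  refine ⟨φ * ψ, mul_mem hφ hψ, ?_⟩
  convert hφ'.mul hψ' using 1
  ext1 <;> simp

/-- If one of the pairings vanishes, the two root subgroups generate a group of triangular
transformations of bounded degree. -/
theorem exists_shiftHom (h₁ : Δ.IsDemazureRoot ρ₁ e₁) (h₂ : Δ.IsDemazureRoot ρ₂ e₂) {c : ℕ}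
    (hc : ρ₂ ⬝ᵥ e₁ = c) (hd : ρ₁ ⬝ᵥ e₂ = 0) :
    ∃ α : TriangularShift.bounded k c →* (Δ.CoordRing k ≃ₐ[k] Δ.CoordRing k),
      Function.Injective α ∧ α.range = rootSubgroup k h₁ ⊔ rootSubgroup k h₂ ∧
      ∀ γ, RepresentsShift h₁.isRayGenerator h₂.isRayGenerator e₁ e₂ c (α γ) γ := by
  choose F hF hF' using fun γ : TriangularShift.bounded k c =>
    exists_representsShift h₁ h₂ hc hd (TriangularShift.natDegree_poly_le γ)
  let α : TriangularShift.bounded k c →* (Δ.CoordRing k ≃ₐ[k] Δ.CoordRing k) :=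
    -- Uniqueness makes the chosen automorphisms multiplicative.
    MonoidHom.mk' F fun γ δ => (hF' (γ * δ)).unique ((hF' γ).mul (hF' δ))
  refine ⟨α, (injective_iff_map_eq_one α).2 fun γ hγ => Subtype.ext ?_, le_antisymm ?_ ?_, hF'⟩
  · refine RepresentsShift.eq_one (h₁ := h₁) (h₂ := h₂.isRayGenerator) (e₂ := e₂) hc ?_
    rw [← hγ]
    exact hF' γ
  · rintro _ ⟨γ, rfl⟩
    exact hF γ
  · refine sup_le ?_ ?_
    · rintro _ ⟨s, rfl⟩
      let γ : TriangularShift.bounded k c := ⟨⟨0, s • X ^ c⟩,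
        (natDegree_smul_le _ _).trans (natDegree_X_pow_le c)⟩
      exact ⟨γ, (hF' γ).unique (representsShift_expAut_left h₁ h₂.isRayGenerator hc e₂ s)⟩
    · rintro _ ⟨t, rfl⟩
      let γ : TriangularShift.bounded k c := ⟨⟨t, 0⟩, by
        change (0 : k[X]).natDegree ≤ c
        simp⟩
      exact ⟨γ, (hF' γ).unique (representsShift_expAut_right h₁.isRayGenerator h₂ hd e₁ c t)⟩

theorem isUnipotentAlgebraicGroup_of_pairing_eq_zero (h₁ : Δ.IsDemazureRoot ρ₁ e₁)
    (h₂ : Δ.IsDemazureRoot ρ₂ e₂) {c : ℕ} (hc : ρ₂ ⬝ᵥ e₁ = c) (hd : ρ₁ ⬝ᵥ e₂ = 0) :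
    IsUnipotentAlgebraicGroup (rootSubgroup k h₁ ⊔ rootSubgroup k h₂) := by
  obtain ⟨α, hinj, hrange, hα⟩ := exists_shiftHom (k := k) h₁ h₂ hc hd
  rw [← hrange]
  refine isUnipotentAlgebraicGroup_of_injective (TriangularShift.rep k c)
    (TriangularShift.rep_injective c) (TriangularShift.isUnipotentLinearAlgebraic_range_rep c)
    α hinj fun f => ?_
  obtain ⟨P, hP⟩ := exists_mvPolynomial_coxPoint hα f
  exact exists_evalEntries_of_embedding (TriangularShift.rep k c) (fun γ => α γ f)
    (coxPoint k h₁.isRayGenerator h₂.isRayGenerator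
      (AddMonoidAlgebra.of k (Fin n → ℤ)) 1 1).toLinearMap
    (coxPoint_one_one_injective h₁.isRayGenerator h₂.isRayGenerator) P hP

theorem not_containsFreeGroupOfRankTwo_of_pairing_eq_zero (h₁ : Δ.IsDemazureRoot ρ₁ e₁)
    (h₂ : Δ.IsDemazureRoot ρ₂ e₂) {c : ℕ} (hc : ρ₂ ⬝ᵥ e₁ = c) (hd : ρ₁ ⬝ᵥ e₂ = 0) :
    ¬ ContainsFreeGroupOfRankTwo ↥(rootSubgroup k h₁ ⊔ rootSubgroup k h₂) := by
  obtain ⟨α, hinj, hrange, -⟩ := exists_shiftHom (k := k) h₁ h₂ hc hd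
  rw [← hrange]
  intro h
  refine TriangularShift.not_containsFreeGroupOfRankTwo (k := k) (h.of_injective
    ((TriangularShift.bounded k c).subtype.comp (MonoidHom.ofInjective hinj).symm.toMonoidHom) ?_)
  exact Subtype.val_injective.comp (MonoidHom.ofInjective hinj).symm.injective

end ToricCone

/-! ### The dichotomy -/

theorem mainTheorem3 {k : Type u} [Field k] [IsAlgClosed k] [CharZero k] {n : ℕ}
    (Δ : ToricCone n) (hX : ¬ HasTorusFactor k (Δ.CoordRing k))
    {ρ₁ ρ₂ e₁ e₂ : Fin n → ℤ} (h₁ : Δ.IsDemazureRoot ρ₁ e₁) (h₂ : Δ.IsDemazureRoot ρ₂ e₂)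
    (hρ : ρ₁ ≠ ρ₂) (H : Subgroup (Δ.CoordRing k ≃ₐ[k] Δ.CoordRing k))
    (hH : H = ToricCone.rootSubgroup k h₁ ⊔ ToricCone.rootSubgroup k h₂) :
    (IsUnipotentAlgebraicGroup H ∨ ContainsFreeGroupOfRankTwo H) ∧
      ¬ (IsUnipotentAlgebraicGroup H ∧ ContainsFreeGroupOfRankTwo H) ∧
      (IsUnipotentAlgebraicGroup H ↔ min (ρ₂ ⬝ᵥ e₁) (ρ₁ ⬝ᵥ e₂) = 0) := by
  subst hH
  obtain ⟨c, hc⟩ := Int.eq_ofNat_of_zero_le (h₁.pairing_nonneg ρ₂ h₂.isRayGenerator hρ.symm)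
  obtain ⟨d, hd⟩ := Int.eq_ofNat_of_zero_le (h₂.pairing_nonneg ρ₁ h₁.isRayGenerator hρ)
  have key : (min (ρ₂ ⬝ᵥ e₁) (ρ₁ ⬝ᵥ e₂) = 0 ∧
      IsUnipotentAlgebraicGroup (ToricCone.rootSubgroup k h₁ ⊔ ToricCone.rootSubgroup k h₂) ∧
      ¬ ContainsFreeGroupOfRankTwo
        ↥(ToricCone.rootSubgroup k h₁ ⊔ ToricCone.rootSubgroup k h₂)) ∨
      (min (ρ₂ ⬝ᵥ e₁) (ρ₁ ⬝ᵥ e₂) ≠ 0 ∧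
      ¬ IsUnipotentAlgebraicGroup (ToricCone.rootSubgroup k h₁ ⊔ ToricCone.rootSubgroup k h₂) ∧
      ContainsFreeGroupOfRankTwo
        ↥(ToricCone.rootSubgroup k h₁ ⊔ ToricCone.rootSubgroup k h₂)) := by
    by_cases hd0 : d = 0
    · have hd' : ρ₁ ⬝ᵥ e₂ = 0 := by rw [hd, hd0]; rfl
      exact Or.inl ⟨by rw [hd', hc]; simp,
        ToricCone.isUnipotentAlgebraicGroup_of_pairing_eq_zero h₁ h₂ hc hd',
        ToricCone.not_containsFreeGroupOfRankTwo_of_pairing_eq_zero h₁ h₂ hc hd'⟩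
    by_cases hc0 : c = 0
    · have hc' : ρ₂ ⬝ᵥ e₁ = 0 := by rw [hc, hc0]; rfl
      -- The case `c = 0` is the previous one with the two roots exchanged.
      rw [sup_comm]
      exact Or.inl ⟨by rw [hd, hc']; simp,
        ToricCone.isUnipotentAlgebraicGroup_of_pairing_eq_zero h₂ h₁ hd hc',
        ToricCone.not_containsFreeGroupOfRankTwo_of_pairing_eq_zero h₂ h₁ hd hc'⟩
    · exact Or.inr ⟨by rw [hc, hd]; omega,
        ToricCone.not_isUnipotentAlgebraicGroup_of_pairing_ne_zero h₁ h₂ hc hd hc0 hd0,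
        ToricCone.containsFreeGroupOfRankTwo_of_pairing_ne_zero h₁ h₂ hc hd hc0 hd0⟩
  tauto
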